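/- **Conventions.** Let $M$ be a (Hausdorff, second countable, non-empty) smooth $3$-manifold with smooth $1$-forms $\omega^1,\omega^2,\omega^3$ that form a basis of every cotangent space and satisfy $d\omega^i=\sum_{j<k}c^i_{jk}\,\omega^j\wedge\omega^k$ with constants $c^i_{jk}$, such that $\theta=\omega^1$ is a contact form. Then $(M,\{\omega^i\},\theta=\omega^1)$ is called a *homogeneous contact manifold*. The dual frame $X_1,X_2,X_3$ satisfies $[X_j,X_k]=-\sum_i c^i_{jk}X_i$ and spans the *Lie algebra* of the homogeneous contact manifold. The frame $X_2,X_3$ of $\xi=\ker\theta$ is ordered so that $d\theta(X_2,X_3)=c^1_{23}>0$. For $a\in\mathbb R$ and $b,c>0$ the *homogeneous complex structure* $J_{a,b,c}$ on $\xi$ is $$J_{a,b,c}X_2=aX_2+cX_3,\qquad J_{a,b,c}X_3=-\tfrac{1+a^2}{c}X_2-aX_3 ;$$ it is used together with the contact form $\theta_b=b^2\theta$. For a contact form $\theta$ and a complex structure $J$ on $\ker\theta$ with $d\theta(v,Jv)>0$ for $0\ne v\in\ker\theta$, let $\theta^1$ be a smooth complex $1$-form with $\theta^1\circ J=i\theta^1$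 on $\ker\theta$ and $d\theta=i\,\theta^1\wedge\overline{\theta^1}$. The Tanaka–Webster connection form $\omega_1{}^1$ (purely imaginary) and the torsion coefficient $A^1{}_{\bar1}$ are determined by $d\theta^1=\theta^1\wedge\omega_1{}^1+A^1{}_{\bar1}\,\theta\wedge\overline{\theta^1}$. The torsion tensor is $A_{J,\theta}=A^1{}_{\bar1}Z_1\otimes\overline{\theta^1}+\overline{A^1{}_{\bar1}}\,\overline{Z_1}\otimes\theta^1$, where $Z_1,\overline{Z_1}$ is the frame of $\ker\theta\otimes\mathbb C$ dual to $\theta^1,\overline{\theta^1}$, and the Webster curvature $W$ is the coefficient of $\theta^1\wedge\overline{\theta^1}$ in $d\omega_1{}^1$. The *normalized torsion flow* is $$\partial_tJ_t=2A_{J_t,\theta_t},\qquad \partial_t\theta_t=-2(W_t-\overline W_t)\,\theta_t ,$$ where $\overline W_t$ is the mean of $W_t$ with respect to $\theta_t\wedge d\theta_t$ (the number with $\int_M(W_t-\overline W_t)\,\theta_t\wedge d\theta_t=0$). **Theorem.** Let $(M,\{\omega^i\},\theta=\omega^1)$ be a homogeneous contact manifold, with $c^1_{23}>0$, whose Lie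 algebra is isomorphic to $\mathfrak{su}(2)$. Then there is exactly one pair $(a_\infty,c_\infty)\in\mathbb R\times\mathbb R_{>0}$ for which $(\theta,J_{a_\infty,1,c_\infty})$ is torsion free. Moreover, for all $a_0\in\mathbb R$ and $c_0>0$ the normalized torsion flow starting at $(\theta,J_{a_0,1,c_0})$ converges to $(\theta,J_{a_\infty,1,c_\infty})$: there is a solution $(\theta,J_{a(t),1,c(t)})$ for all $t\ge0$ with $a(0)=a_0$, $c(0)=c_0$, one has $(a(t),c(t))\to(a_\infty,c_\infty)$ as $t\to\infty$, and every solution of the form $(b(t)^2\theta,J_{\alpha(t),b(t),\gamma(t)})$ on an interval $[0,T)$ with $\alpha(0)=a_0$, $b(0)=1$, $\gamma(0)=c_0$ coincides with it there. In particular this holds on $SU(2)=S^3$, the unit sphere of the quaternions $\mathbb H=\mathbb C^2$, and the limit is the standard CR structure. Precisely, let $p_1,p_2,p_3$ be a basis of the imaginary quaternions with $\langle p_1p_2,p_3\rangle>0$ and $\omega^i_z(v)=\langle p_iz,v\rangle$ for $v\in T_zS^3$. Then $(S^3,\{\omega^i\},\omega^1)$ is a homogeneous contact manifold with $c^1_{23}>0$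 and Lie algebra $\mathfrak{su}(2)$, and for every initial $J_{a_0,1,c_0}$ the normalized torsion flow converges, in the above sense, to the torsion free structure $J_{a_\infty,1,c_\infty}$ which is left multiplication by $p_1/|p_1|$ on $\ker\omega^1$. For $(p_1,p_2,p_3)=(i,j,k)$ this is the standard CR structure $J=i$ of $S^3\subset\mathbb C^2$. -/

import Mathlib

open Set Filter MeasureTheory
open scoped Topology Manifold ContDiff Quaternion InnerProductSpace

namespace TorsionFlow

/-- The model space of the three-dimensional manifolds below. -/
abbrev E3 : Type := EuclideanSpace ℝ (Fin 3)

section Forms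

variable {M : Type*} [TopologicalSpace M] [ChartedSpace E3 M]
variable {F : Type*} [NormedAddCommGroup F] [NormedSpace ℝ F]

variable (M) in
/-- (Not necessarily smooth) `F`-valued 1-forms on the 3-manifold `M`; below `F` is `ℝ` or `ℂ`. -/
abbrev OneForm (F : Type*) [NormedAddCommGroup F] [NormedSpace ℝ F] : Type _ :=
  (x : M) → TangentSpace (𝓡 3) x →L[ℝ] F

variable (M) in
/-- Fields of endomorphisms of the tangent spaces of `M`. -/
abbrev EndField : Type _ :=
  (x : M) → TangentSpace (𝓡 3) x →L[ℝ] TangentSpace (𝓡 3) x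

/-- The 1-form `η` written in the preferred chart `φ` at `x₀`, i.e. the pullback `(φ⁻¹)^* η`;
meaningful on the target of the chart. -/
noncomputable def chartForm (η : OneForm M F) (x₀ : M) (y : E3) : E3 →L[ℝ] F :=
  (η ((extChartAt (𝓡 3) x₀).symm y)).comp
    (mfderiv 𝓘(ℝ, E3) (𝓡 3) (extChartAt (𝓡 3) x₀).symm y)

/-- A 1-form is smooth if it is so in all preferred charts. -/
def SmoothForm (η : OneForm M F) : Prop :=
  ∀ x₀ : M, ContDiffOn ℝ ∞ (chartForm η x₀) (extChartAt (𝓡 3) x₀).target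

/-- Exterior derivative of a 1-form on `ℝ³`: `dΩ(u, v) = u(Ω(v)) - v(Ω(u))`
for constant fields `u`, `v`. -/
noncomputable def flatD (Ω : E3 → E3 →L[ℝ] F) (y u v : E3) : F :=
  fderiv ℝ Ω y u v - fderiv ℝ Ω y v u

/-- Exterior derivative `(dη)_x (u, v)` of a 1-form on `M`, computed in the chart at `x`,
with the convention `dη(X, Y) = X(η(Y)) - Y(η(X)) - η([X, Y])`. -/
noncomputable def extD (η : OneForm M F) (x : M) (u v : TangentSpace (𝓡 3) x) : F :=
  flatD (chartForm η x) (extChartAt (𝓡 3) x x)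
    (mvfderiv (𝓡 3) (extChartAt (𝓡 3) x) x u)
    (mvfderiv (𝓡 3) (extChartAt (𝓡 3) x) x v)

end Forms

/-- Wedge product of two 1-forms on a vector space, `(α ∧ β)(u, v) = α(u) β(v) - α(v) β(u)`. -/
def wedge {V R : Type*} [CommRing R] (α β : V → R) (u v : V) : R :=
  α u * β v - α v * β u

/-- Wedge product of a 1-form and a 2-form on a vector space. -/
def wedge12 {V R : Type*} [CommRing R] (α : V → R) (η : V → V → R) (u v w : V) : R :=
  α u * η v w + α v * η w u + α w * η u v

section CR

variable {M : Type*} [TopologicalSpace M] [ChartedSpace E3 M]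

/-- `θ` is a contact form: it is smooth and `θ ∧ dθ` vanishes nowhere. -/
def IsContact (θ : OneForm M ℝ) : Prop :=
  SmoothForm θ ∧
    ∀ x : M, ∃ u v w : TangentSpace (𝓡 3) x, wedge12 (θ x) (extD θ x) u v w ≠ 0

/-- `(θ, J)` is a strictly pseudoconvex pseudohermitian structure: `θ` is a contact form and `J`
is a complex structure on the contact planes `ξ = ker θ`, compatible with `dθ`. (In dimension 3 the
integrability condition is automatic.) Only the restriction of `J` to `ξ` matters; its smoothness is
that of the form `θ¹` in `TanakaWebster`. -/
structure IsPseudohermitian (θ : OneForm M ℝ) (J : EndField M) : Prop where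
  contact : IsContact θ
  maps_to : ∀ x v, θ x v = 0 → θ x (J x v) = 0
  sq : ∀ x v, θ x v = 0 → J x (J x v) = -v
  compatible : ∀ x v, θ x v = 0 → v ≠ 0 → 0 < extD θ x v (J x v)

/-- The Tanaka-Webster connection of `(θ, J)` (on a 3-manifold on which the contact planes are
trivial), in terms of a unitary coframe `θ, θ¹, conj θ¹`. The form `θ¹` is of type `(1, 0)`
with `dθ = i θ¹ ∧ conj θ¹` (this forces `θ¹(T) = 0` for the Reeb field `T`). The connection form
`conn = ω₁¹` is purely imaginary and
`dθ¹ = θ¹ ∧ ω₁¹ + θ ∧ τ¹` with the pseudohermitian torsion `τ¹ = A conj θ¹`, where `A` is the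
component of the torsion with upper index `1` and lower index `1bar`.
The Webster curvature `W` is the coefficient of `θ¹ ∧ conj θ¹` in `d ω₁¹`, i.e.
`d ω₁¹ = W θ¹ ∧ conj θ¹` on the contact planes. -/
structure TanakaWebster (θ : OneForm M ℝ) (J : EndField M) where
  θ1 : OneForm M ℂ
  conn : OneForm M ℂ
  A : M → ℂ
  W : M → ℝ
  smooth_θ1 : SmoothForm θ1
  smooth_conn : SmoothForm conn
  type10 : ∀ x v, θ x v = 0 → θ1 x (J x v) = Complex.I * θ1 x v
  unitary : ∀ x u v, ((extD θ x u v : ℝ) : ℂ) =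
    Complex.I * wedge (θ1 x) (fun w => starRingEnd ℂ (θ1 x w)) u v
  skew : ∀ x v, conn x v + starRingEnd ℂ (conn x v) = 0
  structure_eq : ∀ x u v, extD θ1 x u v =
    wedge (θ1 x) (conn x) u v +
      wedge (fun w => (θ x w : ℂ)) (fun w => A x * starRingEnd ℂ (θ1 x w)) u v
  curvature_eq : ∀ x u v, θ x u = 0 → θ x v = 0 →
    extD conn x u v = W x * wedge (θ1 x) (fun w => starRingEnd ℂ (θ1 x w)) u v

/-- For `v ∈ ξ = ker θ`, the vector `w` is the value at `v` of the torsion tensor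
`A_{J,θ} = A Z₁ ⊗ conj θ¹ + conj A conj Z₁ ⊗ θ¹`, where `Z₁, conj Z₁` is the frame of `ξ ⊗ ℂ` dual to
`θ¹, conj θ¹`: it is the vector of `ξ` with `θ¹(w) = A conj (θ¹(v))`. -/
def TanakaWebster.IsTorsionValue {θ : OneForm M ℝ} {J : EndField M} (D : TanakaWebster θ J)
    (x : M) (v w : TangentSpace (𝓡 3) x) : Prop :=
  θ x w = 0 ∧ D.θ1 x w = D.A x * starRingEnd ℂ (D.θ1 x v)

/-- The pseudohermitian structure `(θ, J)` is torsion free. -/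
def IsTorsionFree (θ : OneForm M ℝ) (J : EndField M) : Prop :=
  ∃ D : TanakaWebster θ J, ∀ x, D.A x = 0

/-- The absolute value of the density of the volume form `θ ∧ dθ` in the chart at `x₀`. -/
noncomputable def chartDensity (θ : OneForm M ℝ) (x₀ : M) (y : E3) : ℝ :=
  |wedge12 (chartForm θ x₀ y) (flatD (chartForm θ x₀) y)
    (EuclideanSpace.single 0 1) (EuclideanSpace.single 1 1) (EuclideanSpace.single 2 1)|

/-- The measure on (the Borel sets of) `M` given by the volume form `θ ∧ dθ`: the least measure that
dominates the measures with the local densities `|θ ∧ dθ|` in all the charts. (On a second countable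
manifold it restricts to that measure on the domain of every chart.) -/
noncomputable def contactVolume (θ : OneForm M ℝ) : @Measure M (borel M) :=
  letI : MeasurableSpace M := borel M
  ⨆ x₀ : M, Measure.map (extChartAt (𝓡 3) x₀).symm
    ((volume.restrict (extChartAt (𝓡 3) x₀).target).withDensity
      (fun y => ENNReal.ofReal (chartDensity θ x₀ y)))

/-- The number `m` is the mean value of the function `W` with respect to `θ ∧ dθ`,
written as `∫ (W - m) θ ∧ dθ = 0`. If `M` is closed, or more generally of finite volume, and `W` is
integrable, this says `m = ∫ W θ ∧ dθ / ∫ θ ∧ dθ`; in this form it also makes sense for constant `W`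
on a manifold of infinite volume. -/
def IsMean (θ : OneForm M ℝ) (W : M → ℝ) (m : ℝ) : Prop :=
  letI : MeasurableSpace M := borel M
  Integrable (fun x => W x - m) (contactVolume θ) ∧ ∫ x, (W x - m) ∂(contactVolume θ) = 0

/-- `(θ_t, J_t)`, `t ∈ S`, is a solution of the normalized torsion flow
`∂_t J = 2 A_{J,θ}`, `∂_t θ = -2 (W - Wbar) θ`, where `Wbar` is the mean of `W`.
(One-sided derivatives at end points of `S`.) The first equation is one of endomorphisms of
the contact planes, which are independent of `t` by the second one. -/
def IsNormalizedTorsionFlow (S : Set ℝ) (θ : ℝ → OneForm M ℝ) (J : ℝ → EndField M) : Prop :=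
  ∀ t ∈ S, IsPseudohermitian (θ t) (J t) ∧
    ∃ D : TanakaWebster (θ t) (J t),
      (∀ (x : M) (v : TangentSpace (𝓡 3) x), θ t x v = 0 →
        ∃ w : TangentSpace (𝓡 3) x, D.IsTorsionValue x v w ∧
          HasDerivWithinAt (fun s => J s x v) ((2 : ℝ) • w) S t) ∧
      ∃ Wbar : ℝ, IsMean (θ t) D.W Wbar ∧
        ∀ (x : M) (v : TangentSpace (𝓡 3) x),
          HasDerivWithinAt (fun s => θ s x v) (-2 * (D.W x - Wbar) * θ t x v) S t

end CR

section Homogeneous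

variable {M : Type*} [TopologicalSpace M] [ChartedSpace E3 M]

/-- `(M, {e⁰, e¹, e²}, θ = e⁰)` is a homogeneous contact manifold with structure coefficients
`c i j k`, `j < k` (indices run through `0, 1, 2`): the smooth 1-forms `e i` are a basis of the
cotangent spaces, `de^i = ∑_{j<k} c^i_{jk} e^j ∧ e^k`, and `e⁰` is a contact form. -/
structure IsHomogeneousContact (e : Fin 3 → OneForm M ℝ) (c : Fin 3 → Fin 3 → Fin 3 → ℝ) :
    Prop where
  smooth : ∀ i, SmoothForm (e i)
  basis : ∀ x, LinearIndependent ℝ (fun i => e i x)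
  structure_eq : ∀ i x u v, extD (e i) x u v =
    ∑ j, ∑ k ∈ Finset.Ioi j, c i j k * wedge (e j x) (e k x) u v
  contact : IsContact (e 0)

/-- The frame `X₀, X₁, X₂` dual to the coframe `e⁰, e¹, e²`. -/
noncomputable def dualFrame (e : Fin 3 → OneForm M ℝ) (i : Fin 3) (x : M) :
    TangentSpace (𝓡 3) x :=
  (ContinuousLinearMap.pi (fun j => e j x)).inverse (Pi.single i 1)

/-- The homogeneous complex structure
`J_{a,b,c} = a X₁ ⊗ e¹ + c X₂ ⊗ e¹ - (1 + a²)/c X₁ ⊗ e² - a X₂ ⊗ e²`, which does not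
depend on the scale `b` of the contact form `θ_b = b² e⁰`. -/
noncomputable def homJ (e : Fin 3 → OneForm M ℝ) (a c : ℝ) : EndField M := fun x =>
  (e 1 x).smulRight (a • dualFrame e 1 x + c • dualFrame e 2 x) +
    (e 2 x).smulRight (-((1 + a ^ 2) / c) • dualFrame e 1 x - a • dualFrame e 2 x)

/-- The normalized torsion flow of homogeneous CR structures on `(M, e⁰)` starting at
`(e⁰, J_{a₀,1,c₀})` converges to `(e⁰, J_{a',1,c'})`: there is a solution
`(e⁰, J_{a(t),1,c(t)})` for all times `t ≥ 0`, its coefficients converge to `a'` and `c'`,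
and every solution of the form `(b(t)² e⁰, J_{a(t),b(t),c(t)})` with these initial values, on any
time interval `[0, T)`, coincides with it. -/
def FlowConverges (e : Fin 3 → OneForm M ℝ) (a₀ c₀ a' c' : ℝ) : Prop :=
  ∃ a c : ℝ → ℝ, a 0 = a₀ ∧ c 0 = c₀ ∧ (∀ t, 0 ≤ t → 0 < c t) ∧
    IsNormalizedTorsionFlow (Ici 0) (fun _ => e 0) (fun t => homJ e (a t) (c t)) ∧
    Tendsto a atTop (𝓝 a') ∧ Tendsto c atTop (𝓝 c') ∧
    ∀ (T : ℝ) (α β γ : ℝ → ℝ), α 0 = a₀ → β 0 = 1 → γ 0 = c₀ →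
      (∀ t ∈ Ico 0 T, 0 < β t ∧ 0 < γ t) →
      IsNormalizedTorsionFlow (Ico 0 T) (fun t x => (β t) ^ 2 • e 0 x)
        (fun t => homJ e (α t) (γ t)) →
      ∀ t ∈ Ico 0 T, α t = a t ∧ β t = 1 ∧ γ t = c t

attribute [local instance 100] LieRing.ofAssociativeRing

/-- The Lie algebra `su(2)` of traceless skew-hermitian complex `2 × 2` matrices. -/
def su2 : LieSubalgebra ℝ (Matrix (Fin 2) (Fin 2) ℂ) where
  carrier := {A | A.conjTranspose = -A ∧ A.trace = 0}
  add_mem' := by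
    rintro A B ⟨hA, hA'⟩ ⟨hB, hB'⟩
    refine ⟨?_, ?_⟩
    · rw [Matrix.conjTranspose_add, hA, hB]; abel
    · rw [Matrix.trace_add, hA', hB', add_zero]
  zero_mem' := by simp
  smul_mem' := by
    rintro r A ⟨hA, hA'⟩
    refine ⟨?_, ?_⟩
    · rw [Matrix.conjTranspose_smul, hA]; simp
    · rw [Matrix.trace_smul, hA', smul_zero]
  lie_mem' := by
    rintro A B ⟨hA, -⟩ ⟨hB, -⟩
    refine ⟨?_, ?_⟩
    · rw [Ring.lie_def, Matrix.conjTranspose_sub, Matrix.conjTranspose_mul,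
        Matrix.conjTranspose_mul, hA, hB]
      simp
    · rw [Ring.lie_def, Matrix.trace_sub, Matrix.trace_mul_comm, sub_self]

/-- The Lie algebra of a homogeneous contact manifold with structure coefficients `c`, which has a
basis `X₀, X₁, X₂` with `[X_j, X_k] = - ∑_i c^i_{jk} X_i` for `j < k`, is isomorphic to `su(2)`:
there is a basis of `su(2)` with these brackets. -/
def LieAlgebraIsSU2 (c : Fin 3 → Fin 3 → Fin 3 → ℝ) : Prop :=
  ∃ X : Module.Basis (Fin 3) ℝ su2,
    ∀ j k : Fin 3, j < k → ⁅X j, X k⁆ = -∑ i, c i j k • X i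

end Homogeneous

section SU2

instance finrankQuaternion : Fact (Module.finrank ℝ ℍ[ℝ] = 3 + 1) :=
  ⟨Quaternion.finrank_eq_four⟩

/-- The group `SU(2) = S³` of unit quaternions, the unit sphere of `ℂ² = ℍ`. -/
abbrev S3 : Type := Metric.sphere (0 : ℍ[ℝ]) 1

/-- The inclusion of the tangent space `T_z S³` in `ℍ`. -/
noncomputable def tangentIncl (z : S3) : TangentSpace (𝓡 3) z →L[ℝ] ℍ[ℝ] :=
  mvfderiv (𝓡 3) (fun y : S3 => (y : ℍ[ℝ])) z

/-- The invariant 1-form `v ↦ ⟪p z, v⟫` on `S³` defined by the imaginary quaternion `p`. With the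
function `f(z) = |z|²/2` it is `-df ∘ p`, where `p` acts by multiplication from the left. -/
noncomputable def invForm (p : ℍ[ℝ]) : OneForm S3 ℝ := fun z =>
  (innerSL ℝ (p * (z : ℍ[ℝ]))).comp (tangentIncl z)

end SU2

end TorsionFlow

/-! The proof rests on how the Reeb field acts on the contact planes. Subtracting multiples of e⁰
from e¹, e² gives forms f¹, f² that vanish on the Reeb field T. For `su(2)` the structure constants
form a definite symmetric matrix, so the Lie derivative along T sends f¹, f² to s f¹∘J', s f²∘J'
with s > 0 and a homogeneous complex structure J' = J_{a',c'} (`IsReduced`,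
`IsHomogeneousContact.exists_isReduced`).

The matrices J = J_{a,c} with c > 0 are trace free of determinant 1. They form one sheet of a
hyperboloid, the hyperbolic plane, and g = -tr(JJ')/2 is the hyperbolic cosine of the distance from
J to J'. The torsion of (e⁰, J) is A = s(J' - gJ), the tangential part of sJ' at J, and W = sg is
constant (`torsionCoeff_eq`, `torsionCoeff_mul_conj`, `exists_tanakaWebster`). If the torsion
vanishes, then J' = gJ, and determinant and sign force J = J'.

As W is constant, it equals its mean and e⁰ does not move. The flow is ∂ₜJ = 2s(J' - gJ), which runs
along the geodesic from J₀ to J' and is solved by (J₀ + uJ')/ρ with hyperbolic functions u, ρ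
(`exists_isCoeffFlow`). The distance of two solutions does not increase, whence uniqueness
(`IsCoeffFlow.eq`). A competing solution with a scale b(t) has b = 1, because its own equation makes
W minus the mean constant on M, hence zero (`scale_eq_one`).

On S³ the Reeb field is z ↦ p₁z/|p₁|², which identifies J' up to a positive factor as left
multiplication by p₁; J'² = -1 fixes the factor (`tangentIncl_homJ`). -/

namespace TorsionFlow

/-! ### Exterior calculus in the preferred charts, and positivity of the contact volume -/

section FormCalculus

variable {M : Type*} [TopologicalSpace M] [ChartedSpace E3 M]
variable {F : Type*} [NormedAddCommGroup F] [NormedSpace ℝ F]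

/-- The tangent space at `x` is identified with `E3` by the preferred chart at `x` itself, so at
this point the derivative of the chart is the identity. -/
theorem chartForm_apply_self [IsManifold (𝓡 3) ∞ M] (η : OneForm M F) (x : M) :
    chartForm η x (extChartAt (𝓡 3) x x) = η x := by
  have h := mfderivWithin_range_extChartAt_symm (I := 𝓡 3) (x := x)
  simp only [modelWithCornersSelf_coe, range_id, mfderivWithin_univ] at h
  unfold chartForm
  rw [h, extChartAt_to_inv]
  rfl

theorem chartForm_apply (η : OneForm M F) (x : M) (y v : E3) :
    chartForm η x y v = η ((extChartAt (𝓡 3) x).symm y)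
      (mfderiv 𝓘(ℝ, E3) (𝓡 3) (extChartAt (𝓡 3) x).symm y v) :=
  rfl

theorem mvfderiv_extChartAt_self [IsManifold (𝓡 3) ∞ M] (x : M) (u : TangentSpace (𝓡 3) x) :
    mvfderiv (𝓡 3) (extChartAt (𝓡 3) x) x u = u := by
  have h := mfderiv_extChartAt_self (I := 𝓡 3) (x := x)
  unfold mvfderiv
  rw [h]
  rfl

theorem extD_eq_flatD [IsManifold (𝓡 3) ∞ M] (η : OneForm M F) (x : M)
    (u v : TangentSpace (𝓡 3) x) :
    extD η x u v = flatD (chartForm η x) (extChartAt (𝓡 3) x x) u v := by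
  unfold extD
  rw [mvfderiv_extChartAt_self, mvfderiv_extChartAt_self]

theorem SmoothForm.differentiableAt {η : OneForm M F} (h : SmoothForm η) (x : M) :
    DifferentiableAt ℝ (chartForm η x) (extChartAt (𝓡 3) x x) :=
  ((h x).contDiffAt (extChartAt_target_mem_nhds x)).differentiableAt (by simp)

/-- The `F`-valued form `∑ e i ⊗ z i` with constant coefficients. -/
noncomputable def lincomb (e : Fin 3 → OneForm M ℝ) (z : Fin 3 → F) : OneForm M F :=
  fun x => ∑ i, (e i x).smulRight (z i)

theorem lincomb_apply (e : Fin 3 → OneForm M ℝ) (z : Fin 3 → F) (x : M)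
    (v : TangentSpace (𝓡 3) x) : lincomb e z x v = ∑ i, e i x v • z i := by
  simp [lincomb]

theorem chartForm_lincomb (e : Fin 3 → OneForm M ℝ) (z : Fin 3 → F) (x : M) (y : E3) :
    chartForm (lincomb e z) x y =
      ∑ i, ContinuousLinearMap.smulRightL ℝ E3 F (chartForm (e i) x y) (z i) := by
  refine ContinuousLinearMap.ext fun v => ?_
  rw [chartForm_apply, lincomb_apply, sum_apply]
  rfl

theorem SmoothForm.lincomb {e : Fin 3 → OneForm M ℝ} (he : ∀ i, SmoothForm (e i))
    (z : Fin 3 → F) : SmoothForm (lincomb e z) := by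
  intro x
  have : chartForm (TorsionFlow.lincomb e z) x = fun y =>
      ∑ i, ContinuousLinearMap.smulRightL ℝ E3 F (chartForm (e i) x y) (z i) :=
    funext (chartForm_lincomb e z x)
  rw [this]
  refine ContDiffOn.sum fun i _ => ?_
  have h1 : ContDiff ℝ ∞ (fun L : E3 →L[ℝ] ℝ =>
      ContinuousLinearMap.smulRightL ℝ E3 F L (z i)) :=
    ((ContinuousLinearMap.smulRightL ℝ E3 F).flip (z i)).contDiff
  exact h1.comp_contDiffOn (he i x)

theorem extD_lincomb [IsManifold (𝓡 3) ∞ M] {e : Fin 3 → OneForm M ℝ}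
    (he : ∀ i, SmoothForm (e i)) (z : Fin 3 → F) (x : M) (u v : TangentSpace (𝓡 3) x) :
    extD (lincomb e z) x u v = ∑ i, extD (e i) x u v • z i := by
  have hd : HasFDerivAt (chartForm (lincomb e z) x)
      (∑ i, ((ContinuousLinearMap.smulRightL ℝ E3 F).flip (z i)).comp
        (fderiv ℝ (chartForm (e i) x) (extChartAt (𝓡 3) x x))) (extChartAt (𝓡 3) x x) := by
    have : chartForm (lincomb e z) x = fun y =>
      ∑ i, (ContinuousLinearMap.smulRightL ℝ E3 F).flip (z i) (chartForm (e i) x y) :=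
      funext (chartForm_lincomb e z x)
    rw [this]
    refine HasFDerivAt.fun_sum fun i _ => ?_
    exact (ContinuousLinearMap.hasFDerivAt _).comp _ ((he i).differentiableAt x).hasFDerivAt
  have key : ∀ u v : E3, flatD (chartForm (lincomb e z) x) (extChartAt (𝓡 3) x x) u v =
      ∑ i, flatD (chartForm (e i) x) (extChartAt (𝓡 3) x x) u v • z i := by
    intro u v
    simp only [flatD, hd.fderiv]
    simp [sub_smul]
  simp only [extD_eq_flatD]
  exact key u v

/-- The Leibniz rule for forms `η = g φ`; the smoothness of `g` follows from that of `η`, `φ`. -/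
theorem exists_extD_eq_of_eq_smul [IsManifold (𝓡 3) ∞ M] {η φ : OneForm M ℂ} {g : M → ℂ}
    (hη : SmoothForm η) (hφ : SmoothForm φ) (h : ∀ y, η y = g y • φ y) (x : M)
    (v₀ : TangentSpace (𝓡 3) x) (hv₀ : φ x v₀ ≠ 0) :
    ∃ l : TangentSpace (𝓡 3) x → ℂ, ∀ u v, extD η x u v =
      l u * φ x v - l v * φ x u + g x * extD φ x u v := by
  set y₀ := extChartAt (𝓡 3) x x
  set Ω : E3 → E3 →L[ℝ] ℂ := chartForm η x
  set Φ : E3 → E3 →L[ℝ] ℂ := chartForm φ x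
  have hΩΦ : ∀ y, Ω y = g ((extChartAt (𝓡 3) x).symm y) • Φ y := by
    intro y
    refine ContinuousLinearMap.ext fun w => ?_
    simp only [Ω, Φ, smul_apply, chartForm_apply, h]
  have hΦ₀ : Φ y₀ = φ x := chartForm_apply_self φ x
  have hdΩ : DifferentiableAt ℝ Ω y₀ := hη.differentiableAt x
  have hdΦ : DifferentiableAt ℝ Φ y₀ := hφ.differentiableAt x
  let w₀ : E3 := v₀
  have hw₀ : Φ y₀ w₀ ≠ 0 := by rw [hΦ₀]; exact hv₀
  -- The factor `g`, read in the chart, is locally a quotient of two differentiable functions. Its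
  -- derivative is the `l` sought.
  let G : E3 → ℂ := fun y => Ω y w₀ / Φ y w₀
  have hdΩ' : DifferentiableAt ℝ (fun y => Ω y w₀) y₀ := hdΩ.clm_apply (differentiableAt_const w₀)
  have hdΦ' : DifferentiableAt ℝ (fun y => Φ y w₀) y₀ := hdΦ.clm_apply (differentiableAt_const w₀)
  have hG : DifferentiableAt ℝ G y₀ :=  by
    simp only [G, div_eq_mul_inv]
    exact hdΩ'.fun_mul (hdΦ'.fun_inv hw₀)
  have hev : Ω =ᶠ[𝓝 y₀] fun y => G y • Φ y := by
    filter_upwards [hdΦ'.continuousAt.eventually_ne hw₀] with y hy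
    have : G y = g ((extChartAt (𝓡 3) x).symm y) := by
      simp only [G, hΩΦ y, smul_apply, smul_eq_mul]
      field_simp
    rw [this, hΩΦ y]
  have hG₀ : G y₀ = g x := by
    simp only [G, hΩΦ y₀, smul_apply, smul_eq_mul]
    rw [mul_div_assoc, div_self hw₀, mul_one]
    simp only [y₀, extChartAt_to_inv]
  have key : ∀ u v : E3, flatD Ω y₀ u v =
      fderiv ℝ G y₀ u * Φ y₀ v - fderiv ℝ G y₀ v * Φ y₀ u + g x * flatD Φ y₀ u v := by
    intro u v
    unfold flatD
    rw [hev.fderiv_eq, (hG.hasFDerivAt.fun_smul hdΦ.hasFDerivAt).fderiv, hG₀]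
    simp
    ring
  refine ⟨fun u => fderiv ℝ G y₀ u, fun u v => ?_⟩
  rw [extD_eq_flatD, extD_eq_flatD, ← hΦ₀]
  exact key u v

/-- An alternating trilinear form on ℝ³ is a multiple of the determinant, the factor being its value
on the standard basis. -/
theorem wedge12_eq_zero_of_single (α : E3 →L[ℝ] ℝ) (B : E3 →L[ℝ] E3 →L[ℝ] ℝ)
    (h : wedge12 α (fun u v => B u v - B v u) (EuclideanSpace.single 0 1)
      (EuclideanSpace.single 1 1) (EuclideanSpace.single 2 1) = 0) (u v w : E3) :
    wedge12 α (fun u v => B u v - B v u) u v w = 0 := by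
  have hex : ∀ u : E3, u = u 0 • EuclideanSpace.single 0 1 + u 1 • EuclideanSpace.single 1 1 +
      u 2 • EuclideanSpace.single 2 1 := by
    intro u
    ext i
    fin_cases i <;> simp
  rw [hex u, hex v, hex w]
  simp only [wedge12, map_add, map_smul, add_apply, smul_apply,
    smul_eq_mul] at h ⊢
  generalize (EuclideanSpace.single 0 1 : E3) = s0 at *
  generalize (EuclideanSpace.single 1 1 : E3) = s1 at *
  generalize (EuclideanSpace.single 2 1 : E3) = s2 at *
  linear_combination (u 0 * (v 1 * w 2 - v 2 * w 1) - u 1 * (v 0 * w 2 - v 2 * w 0)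
    + u 2 * (v 0 * w 1 - v 1 * w 0)) * h

/-- The volume dominates the measure of a single chart, whose density is continuous and, by the
contact condition, positive at the centre. -/
theorem contactVolume_ne_zero [IsManifold (𝓡 3) ∞ M] [Nonempty M] {θ : OneForm M ℝ}
    (h : IsContact θ) : contactVolume θ ≠ 0 := by
  let _ : MeasurableSpace M := borel M
  have _ : BorelSpace M := ⟨rfl⟩
  obtain ⟨x⟩ := ‹Nonempty M›
  set y₀ := extChartAt (𝓡 3) x x with hy₀
  set ψ := (extChartAt (𝓡 3) x).symm
  set S := (extChartAt (𝓡 3) x).target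
  have hSo : IsOpen S := isOpen_extChartAt_target x
  have hy₀S : y₀ ∈ S := mem_extChartAt_target x
  intro h0
  have hle : Measure.map ψ ((volume.restrict S).withDensity
      (fun y => ENNReal.ofReal (chartDensity θ x y))) ≤ contactVolume θ :=
    le_iSup (fun x₀ : M => Measure.map (extChartAt (𝓡 3) x₀).symm
      ((volume.restrict (extChartAt (𝓡 3) x₀).target).withDensity
      (fun y => ENNReal.ofReal (chartDensity θ x₀ y)))) x
  rw [h0] at hle
  have hmap := le_antisymm hle (Measure.zero_le _)
  have hψ : AEMeasurable ψ (volume.restrict S) :=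
    (continuousOn_extChartAt_symm x).aemeasurable hSo.measurableSet
  have hψ' : AEMeasurable ψ ((volume.restrict S).withDensity
      (fun y => ENNReal.ofReal (chartDensity θ x y))) :=
    hψ.mono_ac (withDensity_absolutelyContinuous _ _)
  rw [Measure.map_eq_zero_iff hψ'] at hmap
  have hΩ : ContDiffOn ℝ ∞ (chartForm θ x) S := h.1 x
  have hdc : ContinuousOn (fderiv ℝ (chartForm θ x)) S :=
    hΩ.continuousOn_fderiv_of_isOpen hSo (by simp)
  have hcont : ContinuousOn (chartDensity θ x) S := by
    unfold chartDensity wedge12 flatD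
    have := hΩ.continuousOn
    fun_prop
  have hpos : 0 < chartDensity θ x y₀ := by
    obtain ⟨u, v, w, huvw⟩ := h.2 x
    refine abs_pos.2 fun h1 => huvw ?_
    have h2 := wedge12_eq_zero_of_single _ _ h1 u v w
    rw [chartForm_apply_self] at h2
    have h3 : extD θ x = flatD (chartForm θ x) y₀ := by
      ext u v
      exact extD_eq_flatD θ x u v
    rw [h3]
    exact h2
  have hae := withDensity_eq_zero (hcont.aemeasurable hSo.measurableSet).ennreal_ofReal hmap
  have hev : ∀ᶠ y in 𝓝 y₀, y ∈ S ∧ 0 < chartDensity θ x y :=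
    (hSo.eventually_mem hy₀S).and
      ((hcont.continuousAt (hSo.mem_nhds hy₀S)).eventually_const_lt hpos)
  obtain ⟨U, hU, hUo, hyU⟩ := eventually_nhds_iff.1 hev
  have h1 : volume U = 0 := by
    rw [EventuallyEq, ae_restrict_iff' hSo.measurableSet] at hae
    refine measure_mono_null (fun y hy => ?_) hae
    intro hy'
    have h2 := hy' (hU y hy).1
    have h3 := (hU y hy).2
    simp only [Pi.zero_apply, ENNReal.ofReal_eq_zero] at h2
    linarith
  exact (hUo.measure_pos volume ⟨y₀, hyU⟩).ne' h1

end FormCalculus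

/-! ### Coframes, dual frames and the reduced structure equations -/

section Frame

/-- The three forms span the dual space, so a vector they annihilate is annihilated by every
functional, in particular by the inner product with itself. -/
theorem pi_injective_of_linearIndependent (f : Fin 3 → E3 →L[ℝ] ℝ) (h : LinearIndependent ℝ f) :
    Function.Injective (ContinuousLinearMap.pi f) := by
  rw [injective_iff_map_eq_zero]
  intro v hv
  have hfin : Module.finrank ℝ (E3 →L[ℝ] ℝ) = 3 := by
    rw [← (LinearMap.toContinuousLinearMap (𝕜 := ℝ) (E := E3) (F' := ℝ)).finrank_eq,
      Module.finrank_linearMap]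
    simp
  have hspan := h.span_eq_top_of_card_eq_finrank' (by simp [hfin])
  have hle : Submodule.span ℝ (Set.range f) ≤
      LinearMap.ker ((ContinuousLinearMap.apply ℝ ℝ v : (E3 →L[ℝ] ℝ) →L[ℝ] ℝ) :
        (E3 →L[ℝ] ℝ) →ₗ[ℝ] ℝ) := by
    rw [Submodule.span_le]
    rintro _ ⟨i, rfl⟩
    exact congrFun hv i
  rw [hspan] at hle
  have h0 : innerSL ℝ v v = 0 := hle (Submodule.mem_top (x := innerSL ℝ v))
  exact inner_self_eq_zero.1 h0

theorem isInvertible_pi_of_linearIndependent (f : Fin 3 → E3 →L[ℝ] ℝ)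
    (h : LinearIndependent ℝ f) : (ContinuousLinearMap.pi f).IsInvertible := by
  have hinj := pi_injective_of_linearIndependent f h
  let E := (LinearEquiv.ofInjectiveOfFinrankEq (ContinuousLinearMap.pi f : E3 →ₗ[ℝ] (Fin 3 → ℝ))
    hinj (by simp)).toContinuousLinearEquiv
  refine ⟨E, ?_⟩
  ext v
  rfl

variable {M : Type*} [TopologicalSpace M] [ChartedSpace E3 M]

theorem coframe_dualFrame {e : Fin 3 → OneForm M ℝ} {x : M}
    (h : LinearIndependent ℝ (fun i => e i x)) (i j : Fin 3) :
    e i x (dualFrame e j x) = if i = j then 1 else 0 := by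
  have h1 : (ContinuousLinearMap.pi (fun j => e j x)).IsInvertible :=
    isInvertible_pi_of_linearIndependent (fun i => e i x) h
  have h2 := h1.self_apply_inverse (Pi.single j (1 : ℝ))
  have h3 := congrFun h2 i
  rw [Pi.single_apply] at h3
  exact h3

theorem coframe_ext {e : Fin 3 → OneForm M ℝ} {x : M}
    (h : LinearIndependent ℝ (fun i => e i x)) {v w : TangentSpace (𝓡 3) x}
    (hvw : ∀ i, e i x v = e i x w) : v = w :=
  pi_injective_of_linearIndependent (fun i => e i x) h (funext hvw)

theorem coframe_homJ {e : Fin 3 → OneForm M ℝ} {x : M}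
    (h : LinearIndependent ℝ (fun i => e i x)) (a c : ℝ) (v : TangentSpace (𝓡 3) x) :
    e 0 x (homJ e a c x v) = 0 ∧
    e 1 x (homJ e a c x v) = a * e 1 x v - (1 + a ^ 2) / c * e 2 x v ∧
    e 2 x (homJ e a c x v) = c * e 1 x v - a * e 2 x v := by
  have hJ : homJ e a c x v = e 1 x v • (a • dualFrame e 1 x + c • dualFrame e 2 x) +
      e 2 x v • (-((1 + a ^ 2) / c) • dualFrame e 1 x - a • dualFrame e 2 x) := rfl
  rw [hJ]
  simp only [map_add, map_sub, map_smul, coframe_dualFrame h, smul_eq_mul, Fin.reduceEq, if_true,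
    if_false]
  refine ⟨by ring, by ring, by ring⟩

/-- Multiples `p e⁰`, `q e⁰` of the contact form are subtracted from `e¹, e²` such that the
new forms `f¹, f²` vanish on the Reeb field. The structure equations of the coframe `e⁰, f¹, f²` are
`de⁰ = κ f¹ ∧ f²`, `df¹ = s e⁰ ∧ (a f¹ - d f²)`, `df² = s e⁰ ∧ (c f¹ - a f²)` with `cd - a² = 1`. -/
structure IsReduced (e : Fin 3 → OneForm M ℝ) (κ s p q a c d : ℝ) : Prop where
  smooth : ∀ i, SmoothForm (e i)
  basis : ∀ x, LinearIndependent ℝ (fun i => e i x)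
  contact : IsContact (e 0)
  κ_pos : 0 < κ
  s_pos : 0 < s
  c_pos : 0 < c
  det : c * d = 1 + a ^ 2
  d0 : ∀ x u v, extD (e 0) x u v =
    κ * wedge (fun w => e 1 x w - p * e 0 x w) (fun w => e 2 x w - q * e 0 x w) u v
  d1 : ∀ x u v, extD (e 1) x u v - p * extD (e 0) x u v =
    s * wedge (e 0 x) (fun w => a * (e 1 x w - p * e 0 x w) - d * (e 2 x w - q * e 0 x w)) u v
  d2 : ∀ x u v, extD (e 2) x u v - q * extD (e 0) x u v =
    s * wedge (e 0 x) (fun w => c * (e 1 x w - p * e 0 x w) - a * (e 2 x w - q * e 0 x w)) u v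

namespace IsReduced

variable {e : Fin 3 → OneForm M ℝ} {κ s p q a' c' d' : ℝ}

theorem isPseudohermitian (H : IsReduced e κ s p q a' c' d') {a c : ℝ} (hc : 0 < c) :
    IsPseudohermitian (e 0) (homJ e a c) where
  contact := H.contact
  maps_to x v _ := (coframe_homJ (H.basis x) a c v).1
  sq x v hv := by
    refine coframe_ext (H.basis x) ?_
    obtain ⟨h0, h1, h2⟩ := coframe_homJ (H.basis x) a c (homJ e a c x v)
    obtain ⟨h0', h1', h2'⟩ := coframe_homJ (H.basis x) a c v
    intro i
    fin_cases i
    · change e 0 x _ = e 0 x _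
      rw [h0, map_neg, hv, neg_zero]
    · change e 1 x _ = e 1 x _
      rw [h1, map_neg, h1', h2']
      field_simp
      ring
    · change e 2 x _ = e 2 x _
      rw [h2, map_neg, h1', h2']
      field_simp
      ring
  compatible x v hv hv0 := by
    obtain ⟨h0', h1', h2'⟩ := coframe_homJ (H.basis x) a c v
    have hκ := H.κ_pos
    rw [H.d0]
    simp only [wedge, h0', h1', h2', hv, mul_zero, sub_zero]
    -- Completing the square exhibits f¹ ∧ f² on (v, Jv) as a sum of squares over c.
    have key : e 1 x v * (c * e 1 x v - a * e 2 x v) -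
        (a * e 1 x v - (1 + a ^ 2) / c * e 2 x v) * e 2 x v =
        ((c * e 1 x v - a * e 2 x v) ^ 2 + e 2 x v ^ 2) / c := by
      field_simp
      ring
    rw [key]
    have : 0 < (c * e 1 x v - a * e 2 x v) ^ 2 + e 2 x v ^ 2 := by
      by_contra hn
      have h2 : e 2 x v = 0 := by nlinarith [sq_nonneg (e 2 x v), sq_nonneg (c * e 1 x v - a * e 2 x v)]
      have h1 : e 1 x v = 0 := by
        rw [h2] at hn
        have : (c * e 1 x v) ^ 2 ≤ 0 := by nlinarith
        have := pow_eq_zero_iff (two_ne_zero) |>.1 (le_antisymm this (sq_nonneg _))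
        exact (mul_eq_zero.1 this).resolve_left hc.ne'
      refine hv0 (coframe_ext (H.basis x) fun i => ?_)
      rw [map_zero]
      fin_cases i
      exacts [hv, h1, h2]
    positivity

end IsReduced

end Frame

/-! ### The torsion of an arbitrary Tanaka–Webster structure of J -/

section Torsion

/-- The coefficient `h` of the torsion, relative to the coframe `f¹ + τ f²` with `τ = (i - a)/c`. -/
noncomputable def torsionCoeff (s a' c' d' a c : ℝ) : ℂ :=
  -(Complex.I * c * s / 2) *
    (d' + 2 * ((Complex.I - a) / c) * a' + ((Complex.I - a) / c) ^ 2 * c')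

variable {M : Type*} [TopologicalSpace M] [ChartedSpace E3 M]

/-- The form `f¹ + τ f²` with `τ = (i - a)/c`, of type `(1, 0)` for `J_{a,b,c}`. -/
noncomputable def typeForm (e : Fin 3 → OneForm M ℝ) (p q a c : ℝ) : OneForm M ℂ :=
  lincomb e ![-(p + (Complex.I - a) / c * q), 1, (Complex.I - a) / c]

theorem typeForm_apply (e : Fin 3 → OneForm M ℝ) (p q a c : ℝ) (x : M)
    (v : TangentSpace (𝓡 3) x) : typeForm e p q a c x v =
      ((e 1 x v - p * e 0 x v : ℝ) : ℂ) +
        (Complex.I - a) / c * ((e 2 x v - q * e 0 x v : ℝ) : ℂ) := by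
  simp [typeForm, lincomb_apply, Fin.sum_univ_three]
  ring

/-- The Reeb field. -/
noncomputable def reeb (e : Fin 3 → OneForm M ℝ) (p q : ℝ) (x : M) : TangentSpace (𝓡 3) x :=
  dualFrame e 0 x + p • dualFrame e 1 x + q • dualFrame e 2 x

namespace IsReduced

variable {e : Fin 3 → OneForm M ℝ} {κ s p q a' c' d' : ℝ}

theorem coframe_reeb (H : IsReduced e κ s p q a' c' d') (x : M) :
    e 0 x (reeb e p q x) = 1 ∧ e 1 x (reeb e p q x) = p ∧ e 2 x (reeb e p q x) = q := by
  simp only [reeb, map_add, map_smul, coframe_dualFrame (H.basis x), smul_eq_mul, Fin.reduceEq,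
    if_true, if_false]
  refine ⟨by ring, by ring, by ring⟩

theorem coframe_dualFrame_one (H : IsReduced e κ s p q a' c' d') (x : M) :
    e 0 x (dualFrame e 1 x) = 0 ∧ e 1 x (dualFrame e 1 x) = 1 ∧ e 2 x (dualFrame e 1 x) = 0 := by
  simp only [coframe_dualFrame (H.basis x), Fin.reduceEq, if_true, if_false, and_self]

theorem coframe_dualFrame_two (H : IsReduced e κ s p q a' c' d') (x : M) :
    e 0 x (dualFrame e 2 x) = 0 ∧ e 1 x (dualFrame e 2 x) = 0 ∧ e 2 x (dualFrame e 2 x) = 1 := by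
  simp only [coframe_dualFrame (H.basis x), Fin.reduceEq, if_true, if_false, and_self]

theorem homJ_dualFrame_one (H : IsReduced e κ s p q a' c' d') (a c : ℝ) (x : M) :
    homJ e a c x (dualFrame e 1 x) = a • dualFrame e 1 x + c • dualFrame e 2 x := by
  obtain ⟨_, h1, h2⟩ := H.coframe_dualFrame_one x
  have hJ : homJ e a c x (dualFrame e 1 x) =
      e 1 x (dualFrame e 1 x) • (a • dualFrame e 1 x + c • dualFrame e 2 x) +
      e 2 x (dualFrame e 1 x) • (-((1 + a ^ 2) / c) • dualFrame e 1 x - a • dualFrame e 2 x) := rfl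
  rw [hJ, h1, h2, one_smul, zero_smul, add_zero]

theorem frame_expand (H : IsReduced e κ s p q a' c' d') (x : M) (v : TangentSpace (𝓡 3) x) :
    v = e 0 x v • reeb e p q x + (e 1 x v - p * e 0 x v) • dualFrame e 1 x +
      (e 2 x v - q * e 0 x v) • dualFrame e 2 x := by
  refine coframe_ext (H.basis x) fun i => ?_
  obtain ⟨r0, r1, r2⟩ := H.coframe_reeb x
  obtain ⟨s0, s1, s2⟩ := H.coframe_dualFrame_one x
  obtain ⟨t0, t1, t2⟩ := H.coframe_dualFrame_two x
  simp only [map_add, map_smul, smul_eq_mul]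
  fin_cases i
  · change e 0 x v = _ * e 0 x _ + _ * e 0 x _ + _ * e 0 x _
    rw [r0, s0, t0]; ring
  · change e 1 x v = _ * e 1 x _ + _ * e 1 x _ + _ * e 1 x _
    rw [r1, s1, t1]; ring
  · change e 2 x v = _ * e 2 x _ + _ * e 2 x _ + _ * e 2 x _
    rw [r2, s2, t2]; ring

theorem extD_typeForm [IsManifold (𝓡 3) ∞ M] (H : IsReduced e κ s p q a' c' d') (a c : ℝ) (x : M)
    (u v : TangentSpace (𝓡 3) x) :
    extD (typeForm e p q a c) x u v =
      ((s * wedge (e 0 x)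
        (fun w => a' * (e 1 x w - p * e 0 x w) - d' * (e 2 x w - q * e 0 x w)) u v : ℝ) : ℂ) +
      (Complex.I - a) / c * ((s * wedge (e 0 x)
        (fun w => c' * (e 1 x w - p * e 0 x w) - a' * (e 2 x w - q * e 0 x w)) u v : ℝ) : ℂ) := by
  rw [← H.d1, ← H.d2, typeForm, extD_lincomb H.smooth]
  simp [Fin.sum_univ_three]
  ring

/-- The Reeb field T lies in the kernel of dθ. Testing `unitary` on (T, X₁) and (T, JX₁) gives two
equations; in a suitable combination the terms with the conjugate of θ¹(T) cancel. -/
theorem θ1_reeb (H : IsReduced e κ s p q a' c' d') {a c : ℝ}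
    (D : TanakaWebster (e 0) (homJ e a c)) (x : M) (h1 : D.θ1 x (dualFrame e 1 x) ≠ 0) :
    D.θ1 x (reeb e p q x) = 0 := by
  obtain ⟨r0, r1, r2⟩ := H.coframe_reeb x
  obtain ⟨s0, s1, s2⟩ := H.coframe_dualFrame_one x
  have hr : ∀ v, extD (e 0) x (reeb e p q x) v = 0 := by
    intro v
    rw [H.d0]
    simp only [wedge, r0, r1, r2]
    ring
  have u1 := D.unitary x (reeb e p q x) (dualFrame e 1 x)
  have u2 := D.unitary x (reeb e p q x) (homJ e a c x (dualFrame e 1 x))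
  rw [hr] at u1 u2
  simp only [wedge, D.type10 x _ s0, map_mul, Complex.conj_I, Complex.ofReal_zero] at u1 u2
  have h2 : D.θ1 x (reeb e p q x) * starRingEnd ℂ (D.θ1 x (dualFrame e 1 x)) = 0 := by
    linear_combination (Complex.I / 2) * u1 - (1 / 2) * u2 +
      (D.θ1 x (reeb e p q x) * starRingEnd ℂ (D.θ1 x (dualFrame e 1 x))) * Complex.I_sq
  exact (mul_eq_zero.1 h2).resolve_right (by simpa using h1)

theorem θ1_dualFrame_two (H : IsReduced e κ s p q a' c' d') {a c : ℝ} (hc : 0 < c)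
    (D : TanakaWebster (e 0) (homJ e a c)) (x : M) :
    D.θ1 x (dualFrame e 2 x) = (Complex.I - a) / c * D.θ1 x (dualFrame e 1 x) := by
  have h := D.type10 x _ (H.coframe_dualFrame_one x).1
  rw [H.homJ_dualFrame_one, map_add, map_smul, map_smul, Complex.real_smul,
    Complex.real_smul] at h
  have hc' : (c : ℂ) ≠ 0 := by exact_mod_cast hc.ne'
  field_simp
  linear_combination h

theorem θ1_dualFrame_one_ne_zero (H : IsReduced e κ s p q a' c' d') {a c : ℝ} (hc : 0 < c)
    (D : TanakaWebster (e 0) (homJ e a c)) (x : M) :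
    D.θ1 x (dualFrame e 1 x) ≠ 0 := by
  intro h
  have u := D.unitary x (dualFrame e 1 x) (dualFrame e 2 x)
  obtain ⟨s0, s1, s2⟩ := H.coframe_dualFrame_one x
  obtain ⟨t0, t1, t2⟩ := H.coframe_dualFrame_two x
  rw [H.d0] at u
  simp only [wedge, H.θ1_dualFrame_two hc D x, h, s0, s1, s2, t0, t1, t2] at u
  have hκ : (κ : ℂ) ≠ 0 := by exact_mod_cast H.κ_pos.ne'
  apply hκ
  simpa using u

/-- Admissible forms θ¹ differ from the model form only by a complex function, so the torsion of any
given `TanakaWebster` can be computed from the model. -/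
theorem θ1_eq_smul (H : IsReduced e κ s p q a' c' d') {a c : ℝ} (hc : 0 < c)
    (D : TanakaWebster (e 0) (homJ e a c)) (x : M) :
    D.θ1 x = D.θ1 x (dualFrame e 1 x) • typeForm e p q a c x := by
  refine ContinuousLinearMap.ext fun v => ?_
  have hr := H.θ1_reeb D x (H.θ1_dualFrame_one_ne_zero hc D x)
  conv_lhs => rw [H.frame_expand x v]
  rw [smul_apply, typeForm_apply]
  simp only [map_add, map_smul, hr, H.θ1_dualFrame_two hc D x, Complex.real_smul, smul_eq_mul]
  ring

/-- Passing from φ to gφ multiplies the coefficient of e⁰ ∧ conj φ by g / conj g, since dg ∧ φ only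
changes the connection form. -/
theorem A_mul_conj (H : IsReduced e κ s p q a' c' d') [IsManifold (𝓡 3) ∞ M] {a c : ℝ}
    (hc : 0 < c) (D : TanakaWebster (e 0) (homJ e a c)) (x : M) :
    D.A x * starRingEnd ℂ (D.θ1 x (dualFrame e 1 x)) =
      torsionCoeff s a' c' d' a c * D.θ1 x (dualFrame e 1 x) := by
  obtain ⟨r0, r1, r2⟩ := H.coframe_reeb x
  obtain ⟨s0, s1, s2⟩ := H.coframe_dualFrame_one x
  obtain ⟨t0, t1, t2⟩ := H.coframe_dualFrame_two x
  have hc' : (c : ℂ) ≠ 0 := by exact_mod_cast hc.ne'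
  obtain ⟨l, hl⟩ := exists_extD_eq_of_eq_smul D.smooth_θ1
    (SmoothForm.lincomb H.smooth _) (H.θ1_eq_smul hc D) x (dualFrame e 1 x) (by
      change typeForm e p q a c x _ ≠ 0
      rw [typeForm_apply, s0, s1, s2]
      simp)
  have e1 := hl (reeb e p q x) (dualFrame e 1 x)
  have e2 := hl (reeb e p q x) (dualFrame e 2 x)
  change _ = _ * typeForm e p q a c x _ - _ * typeForm e p q a c x _ +
    _ * extD (typeForm e p q a c) x _ _ at e1 e2
  have hr := H.θ1_reeb D x (H.θ1_dualFrame_one_ne_zero hc D x)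
  have h2 := H.θ1_dualFrame_two hc D x
  rw [D.structure_eq, H.extD_typeForm] at e1 e2
  simp only [typeForm_apply, wedge, r0, r1, r2, s0, s1, s2, t0, t1, t2, hr, h2, map_mul, map_div₀,
    map_sub, Complex.conj_I, Complex.conj_ofReal] at e1 e2
  push_cast at e1 e2
  unfold torsionCoeff
  generalize D.θ1 x (dualFrame e 1 x) = g at *
  generalize starRingEnd ℂ g = g' at *
  -- The combination `e2` minus τ times `e1` evaluates the structure equation on T and X₂ - τX₁.
  -- There φ vanishes, which removes dg and the connection form, and conj φ takes the value -2i/c.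
  have key : D.A x * g' * (-2 * Complex.I / c) =
    - (g * s * (d' + 2 * ((Complex.I - a) / c) * a' + ((Complex.I - a) / c) ^ 2 * c')) := by
    linear_combination e2 - (Complex.I - a) / c * e1
  have hI := Complex.I_ne_zero
  field_simp at key ⊢
  linear_combination Complex.I * key + (2 * D.A x * g' * c) * Complex.I_sq

theorem typeForm_torsionValue (H : IsReduced e κ s p q a' c' d') [IsManifold (𝓡 3) ∞ M] {a c : ℝ}
    (hc : 0 < c) (D : TanakaWebster (e 0) (homJ e a c)) {x : M} {v w : TangentSpace (𝓡 3) x}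
    (h : D.IsTorsionValue x v w) : typeForm e p q a c x w =
      torsionCoeff s a' c' d' a c * starRingEnd ℂ (typeForm e p q a c x v) := by
  have h1 := h.2
  have hA := H.A_mul_conj hc D x
  have hg := H.θ1_dualFrame_one_ne_zero hc D x
  rw [H.θ1_eq_smul hc D x, smul_apply, smul_apply, smul_eq_mul, smul_eq_mul, map_mul] at h1
  apply mul_left_cancel₀ hg
  linear_combination h1 + starRingEnd ℂ (typeForm e p q a c x v) * hA

end IsReduced

end Torsion

/-! ### Explicit Tanaka–Webster structure: A = s(J' - gJ) and W = sg -/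

section Existence

/-- `-tr(J J')/2` for the complex structures `J, J'` with coefficients `a, c` and
`a', c', d' = (1 + a'²)/c'`: the hyperbolic cosine of their distance in the hyperbolic plane. -/
noncomputable def coshDist (a' c' d' a c : ℝ) : ℝ :=
  (c * d' + (1 + a ^ 2) / c * c') / 2 - a * a'

/-- Since φ(X₁) = 1, the coefficient is φ(A X₁). The right side is φ applied to the first column of
s(J' - gJ). -/
theorem torsionCoeff_eq (s a' c' d' a c : ℝ) (hc : c ≠ 0) :
    torsionCoeff s a' c' d' a c =
      s * (a' - coshDist a' c' d' a c * a) +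
        (Complex.I - a) / c * (s * (c' - coshDist a' c' d' a c * c)) := by
  have hc' : (c : ℂ) ≠ 0 := by exact_mod_cast hc
  unfold torsionCoeff coshDist
  push_cast
  field_simp
  linear_combination s * (-Complex.I * c' + 2 * a * c' - 2 * c * a') * Complex.I_sq

/-- The same for the second column: φ(X₂) = τ, so the coefficient times conj τ is φ(A X₂). -/
theorem torsionCoeff_mul_conj (s a' c' d' a c : ℝ) (hc : c ≠ 0) :
    torsionCoeff s a' c' d' a c * ((-Complex.I - a) / c) =
      -(s * (d' - coshDist a' c' d' a c * ((1 + a ^ 2) / c)) +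
        (Complex.I - a) / c * (s * (a' - coshDist a' c' d' a c * a))) := by
  have hc' : (c : ℂ) ≠ 0 := by exact_mod_cast hc
  unfold torsionCoeff coshDist
  push_cast
  field_simp
  have h3 : Complex.I ^ 3 = -Complex.I := Complex.I_pow_three
  have h4 : Complex.I ^ 4 = 1 := Complex.I_pow_four
  ring_nf
  simp only [Complex.I_sq, h3, h4]
  ring

variable {M : Type*} [TopologicalSpace M] [ChartedSpace E3 M]

theorem lincomb_const_mul (e : Fin 3 → OneForm M ℝ) (m : ℂ) (z : Fin 3 → ℂ) (x : M) :
    lincomb e (fun i => m * z i) x = m • lincomb e z x := by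
  refine ContinuousLinearMap.ext fun v => ?_
  rw [smul_apply, lincomb_apply, lincomb_apply, Finset.smul_sum]
  refine Finset.sum_congr rfl fun i _ => ?_
  rw [smul_comm, smul_eq_mul]

namespace IsReduced

variable {e : Fin 3 → OneForm M ℝ} {κ s p q a' c' d' : ℝ}

theorem exists_tanakaWebster [IsManifold (𝓡 3) ∞ M] (H : IsReduced e κ s p q a' c' d') {a c : ℝ}
    (hc : 0 < c) : ∃ D : TanakaWebster (e 0) (homJ e a c),
      (∀ x, D.A x = torsionCoeff s a' c' d' a c) ∧ (∀ x, D.W x = s * coshDist a' c' d' a c) ∧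
      ∃ m : ℝ, 0 < m ∧ ∀ x, D.θ1 x = (m : ℂ) • typeForm e p q a c x := by
  have hκ := H.κ_pos
  have hc' : (c : ℂ) ≠ 0 := by exact_mod_cast hc.ne'
  -- For θ¹ = m(f¹ + τf²) the form i θ¹ ∧ conj θ¹ is (2m²/c) f¹ ∧ f², which must be κ f¹ ∧ f².
  have hm : 0 < √(κ * c / 2) := Real.sqrt_pos.2 (by positivity)
  have hm2 : (√(κ * c / 2) : ℂ) * √(κ * c / 2) = κ * c / 2 := by
    have := Real.mul_self_sqrt (show 0 ≤ κ * c / 2 by positivity)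
    exact_mod_cast this
  set m := √(κ * c / 2)
  set τ : ℂ := (Complex.I - a) / c with hτ
  have hτ' : starRingEnd ℂ τ = (-Complex.I - a) / c := by
    rw [hτ, map_div₀, map_sub, Complex.conj_I, Complex.conj_ofReal, Complex.conj_ofReal]
  set g := coshDist a' c' d' a c
  -- The connection form is ζe⁰. Comparing the coefficients of e⁰ ∧ f¹ and e⁰ ∧ f² in dφ gives `k1`
  -- and `k2` below, and de⁰ = i θ¹ ∧ conj θ¹ makes the curvature iζ = sg.
  set ζ : ℂ := -Complex.I * (s * g) with hζ
  have hθ : ∀ x, lincomb e (fun i => (m : ℂ) * ![-(p + τ * q), 1, τ] i) x =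
      (m : ℂ) • typeForm e p q a c x := fun x => lincomb_const_mul e m _ x
  have hθv : ∀ x v, lincomb e (fun i => (m : ℂ) * ![-(p + τ * q), 1, τ] i) x v =
      m * (((e 1 x v - p * e 0 x v : ℝ) : ℂ) + τ * ((e 2 x v - q * e 0 x v : ℝ) : ℂ)) := by
    intro x v
    rw [hθ, smul_apply, typeForm_apply, smul_eq_mul]
  have hconn : ∀ x v, lincomb e ![ζ, 0, 0] x v = e 0 x v * ζ := by
    intro x v
    simp [lincomb_apply, Fin.sum_univ_three]
  have htype : τ * (c : ℂ) = Complex.I - a := by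
    rw [hτ]; field_simp
  let D : TanakaWebster (e 0) (homJ e a c) :=
    { θ1 := lincomb e (fun i => (m : ℂ) * ![-(p + τ * q), 1, τ] i)
      conn := lincomb e ![ζ, 0, 0]
      A := fun _ => torsionCoeff s a' c' d' a c
      W := fun _ => s * g
      smooth_θ1 := SmoothForm.lincomb H.smooth _
      smooth_conn := SmoothForm.lincomb H.smooth _
      type10 := by
        intro x v hv
        obtain ⟨h0, h1, h2⟩ := coframe_homJ (H.basis x) a c v
        rw [hθv, hθv, h0, h1, h2, hv, hτ]
        push_cast
        field_simp
        linear_combination (-(m : ℂ) * e 2 x v) * Complex.I_sq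
      unitary := by
        intro x u v
        rw [H.d0]
        simp only [wedge, hθv, map_mul, map_add, Complex.conj_ofReal, hτ']
        generalize e 1 x u - p * e 0 x u = u1
        generalize e 2 x u - q * e 0 x u = u2
        generalize e 1 x v - p * e 0 x v = v1
        generalize e 2 x v - q * e 0 x v = v2
        push_cast
        rw [hτ]
        field_simp
        linear_combination (-2 * c * (u1 * v2 - v1 * u2)) * hm2 +
          2 * (m : ℂ) ^ 2 * c * (u1 * v2 - v1 * u2) * Complex.I_sq
      skew := by
        intro x v
        rw [hconn, map_mul, Complex.conj_ofReal, hζ]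
        simp
      structure_eq := by
        intro x u v
        have hD : extD (lincomb e (fun i => (m : ℂ) * ![-(p + τ * q), 1, τ] i)) x u v =
            m * extD (typeForm e p q a c) x u v := by
          rw [typeForm, extD_lincomb H.smooth, extD_lincomb H.smooth, Finset.mul_sum]
          refine Finset.sum_congr rfl fun i _ => ?_
          rw [Complex.real_smul, Complex.real_smul]
          ring
        rw [hD, H.extD_typeForm]
        simp only [wedge, hθv, hconn, map_mul, map_add, Complex.conj_ofReal, hτ']
        generalize e 1 x u - p * e 0 x u = u1
        generalize e 2 x u - q * e 0 x u = u2
        generalize e 1 x v - p * e 0 x v = v1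
        generalize e 2 x v - q * e 0 x v = v2
        have h1 := torsionCoeff_eq s a' c' d' a c hc.ne'
        have h2 := torsionCoeff_mul_conj s a' c' d' a c hc.ne'
        push_cast
        rw [← hτ] at h1 h2
        have htI : (a : ℂ) + τ * c = Complex.I := by rw [htype]; ring
        have htI' : ((1 + a ^ 2) / c : ℂ) + τ * a = -Complex.I * τ := by
          rw [hτ]; field_simp; linear_combination Complex.I_sq
        have k1 : torsionCoeff s a' c' d' a c = s * (a' + τ * c') + ζ := by
          linear_combination h1 - s * g * htI
        have k2 : torsionCoeff s a' c' d' a c * ((-Complex.I - a) / c) =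
            -(s * (d' + τ * a')) + ζ * τ := by
          linear_combination h2 + s * g * htI'
        linear_combination (-m * (e 0 x u * v1 - e 0 x v * u1)) * k1
          - (m * (e 0 x u * v2 - e 0 x v * u2)) * k2
      curvature_eq := by
        intro x u v hu hv
        rw [extD_lincomb H.smooth]
        simp only [Fin.sum_univ_three, wedge, hθv, map_mul, map_add, Complex.conj_ofReal, hτ', hu,
          hv, H.d0]
        simp
        have hdiff : (-Complex.I - a) / c - τ = -2 * Complex.I / c := by rw [hτ]; ring
        have hm3 : (m : ℂ) * m / c = κ / 2 := by rw [hm2]; field_simp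
        rw [hζ]
        linear_combination (2 * Complex.I * s * g * (e 1 x u * e 2 x v - e 1 x v * e 2 x u)) * hm3 -
          (s * g * m ^ 2 * (e 1 x u * e 2 x v - e 1 x v * e 2 x u)) * hdiff }
  exact ⟨D, fun _ => rfl, fun _ => rfl, m, hm, hθ⟩

end IsReduced

end Existence

/-! ### The flow ∂ₜJ = 2s(J' - gJ) in the hyperbolic plane -/

section FlowEquation

variable {s a' c' d' : ℝ}

/-- `(a, c)` satisfies the equations `∂ₜ a = 2s (a' - g a)`, `∂ₜ c = 2s (c' - g c)` on `S`, where
`g` is the hyperbolic cosine of the distance to `(a', c')`. -/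
def IsCoeffFlow (s a' c' d' : ℝ) (S : Set ℝ) (a c : ℝ → ℝ) : Prop :=
  ∀ t ∈ S, 0 < c t ∧
    HasDerivWithinAt a (2 * s * (a' - coshDist a' c' d' (a t) (c t) * a t)) S t ∧
    HasDerivWithinAt c (2 * s * (c' - coshDist a' c' d' (a t) (c t) * c t)) S t

theorem IsCoeffFlow.mono {S R : Set ℝ} {a c : ℝ → ℝ} (h : IsCoeffFlow s a' c' d' S a c)
    (hR : R ⊆ S) : IsCoeffFlow s a' c' d' R a c := fun t ht =>
  ⟨(h t (hR ht)).1, (h t (hR ht)).2.1.mono hR, (h t (hR ht)).2.2.mono hR⟩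

/-- The remaining entry of J obeys the same law as a and c, so the flow is a matrix equation. This
works because g is the trace pairing of J and J', which keeps the determinant equal to 1. -/
theorem hasDerivWithinAt_coeff {S : Set ℝ} {a c : ℝ → ℝ} {t g : ℝ} (hc : 0 < c t)
    (hg : g = coshDist a' c' d' (a t) (c t))
    (h1 : HasDerivWithinAt a (2 * s * (a' - g * a t)) S t)
    (h2 : HasDerivWithinAt c (2 * s * (c' - g * c t)) S t) :
    HasDerivWithinAt (fun r => (1 + a r ^ 2) / c r)
      (2 * s * (d' - g * ((1 + a t ^ 2) / c t))) S t := by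
  have h3 := ((h1.fun_pow 2).const_add 1).fun_div h2 hc.ne'
  refine h3.congr_deriv ?_
  have hg' : g * (2 * c t) = c t ^ 2 * d' + (1 + a t ^ 2) * c' - 2 * a t * a' * c t := by
    rw [hg, coshDist]
    field_simp
  field_simp
  norm_num
  linear_combination s * hg'

theorem coshDist_sub_one {a c a₁ c₁ : ℝ} (hc : c ≠ 0) (hc₁ : c₁ ≠ 0) :
    coshDist a₁ c₁ ((1 + a₁ ^ 2) / c₁) a c - 1 =
      ((c * a₁ - c₁ * a) ^ 2 + (c - c₁) ^ 2) / (2 * c * c₁) := by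
  unfold coshDist
  field_simp
  ring

theorem one_le_coshDist {a c a₁ c₁ : ℝ} (hc : 0 < c) (hc₁ : 0 < c₁) :
    1 ≤ coshDist a₁ c₁ ((1 + a₁ ^ 2) / c₁) a c := by
  have := coshDist_sub_one (a := a) (a₁ := a₁) hc.ne' hc₁.ne'
  have h : 0 ≤ ((c * a₁ - c₁ * a) ^ 2 + (c - c₁) ^ 2) / (2 * c * c₁) := by positivity
  linarith

theorem eq_of_coshDist_le_one {a c a₁ c₁ : ℝ} (hc : 0 < c) (hc₁ : 0 < c₁)
    (h : coshDist a₁ c₁ ((1 + a₁ ^ 2) / c₁) a c ≤ 1) : a = a₁ ∧ c = c₁ := by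
  have h1 := coshDist_sub_one (a := a) (a₁ := a₁) hc.ne' hc₁.ne'
  have h2 : ((c * a₁ - c₁ * a) ^ 2 + (c - c₁) ^ 2) / (2 * c * c₁) ≤ 0 := by linarith
  have h3 : (c * a₁ - c₁ * a) ^ 2 + (c - c₁) ^ 2 ≤ 0 := by
    rwa [div_le_iff₀ (by positivity), zero_mul] at h2
  have h4 : c - c₁ = 0 := by
    have := sq_nonneg (c * a₁ - c₁ * a)
    exact pow_eq_zero_iff two_ne_zero |>.1 (le_antisymm (by linarith) (sq_nonneg _))
  have h5 : c * a₁ - c₁ * a = 0 := by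
    have := sq_nonneg (c - c₁)
    exact pow_eq_zero_iff two_ne_zero |>.1 (le_antisymm (by linarith) (sq_nonneg _))
  have h6 : c = c₁ := by linarith
  refine ⟨?_, h6⟩
  rw [h6] at h5
  have : c₁ * (a₁ - a) = 0 := by linarith
  have := (mul_eq_zero.1 this).resolve_left hc₁.ne'
  linarith

/-- The hyperbolic cosine F of the distance of two solutions satisfies F' = -2s(g₁ + g₂)(F - 1) with
g₁, g₂, F ≥ 1. So F does not increase; starting at its minimum 1, it stays there, and F = 1 means
coincidence. -/
theorem IsCoeffFlow.eq (hs : 0 < s) (hc' : 0 < c') (hd' : c' * d' = 1 + a' ^ 2) {T : ℝ}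
    {a c α γ : ℝ → ℝ} (h : IsCoeffFlow s a' c' d' (Ico 0 T) a c)
    (h₁ : IsCoeffFlow s a' c' d' (Ico 0 T) α γ) (ha : α 0 = a 0) (hc : γ 0 = c 0)
    {t : ℝ} (ht : t ∈ Ico 0 T) : α t = a t ∧ γ t = c t := by
  have hd : d' = (1 + a' ^ 2) / c' := by field_simp; linarith
  have hsub : Icc 0 t ⊆ Ico 0 T := fun r hr => ⟨hr.1, hr.2.trans_lt ht.2⟩
  let F : ℝ → ℝ := fun r => coshDist (a r) (c r) ((1 + a r ^ 2) / c r) (α r) (γ r)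
  have hF : ∀ r ∈ Ico 0 T, HasDerivWithinAt F (-(2 * s) *
      (coshDist a' c' d' (a r) (c r) + coshDist a' c' d' (α r) (γ r)) * (F r - 1)) (Ico 0 T) r := by
    intro r hr
    obtain ⟨p1, p2, p3⟩ := h r hr
    obtain ⟨q1, q2, q3⟩ := h₁ r hr
    have p4 := hasDerivWithinAt_coeff p1 rfl p2 p3
    have q4 := hasDerivWithinAt_coeff q1 rfl q2 q3
    have := (((q3.fun_mul p4).fun_add (q4.fun_mul p3)).div_const 2).fun_sub (q2.fun_mul p2)
    refine this.congr_deriv ?_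
    simp only [F, coshDist]
    ring
  have hanti : AntitoneOn F (Icc 0 t) := by
    refine antitoneOn_of_deriv_nonpos (convex_Icc 0 t)
      (fun r hr => ((hF r (hsub hr)).continuousWithinAt).mono hsub) ?_ ?_
    all_goals
      intro r hr
      have hr' := hsub (interior_subset hr)
      rw [interior_Icc] at hr
      have hn : Ico 0 T ∈ 𝓝 r :=
        mem_of_superset (Ioo_mem_nhds hr.1 hr.2) (Ioo_subset_Icc_self.trans hsub)
      have hFr := (hF r hr').hasDerivAt hn
    · exact hFr.differentiableAt.differentiableWithinAt
    · rw [hFr.deriv]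
      have g1 := one_le_coshDist (a := a r) (a₁ := a') (h r hr').1 hc'
      have g2 := one_le_coshDist (a := α r) (a₁ := a') (h₁ r hr').1 hc'
      have g3 := one_le_coshDist (a := α r) (a₁ := a r) (h₁ r hr').1 (h r hr').1
      rw [← hd] at g1 g2
      have : 0 ≤ 2 * s * (coshDist a' c' d' (a r) (c r) + coshDist a' c' d' (α r) (γ r)) *
          (F r - 1) :=
        mul_nonneg (mul_nonneg (by positivity) (by linarith)) (sub_nonneg.2 g3)
      linarith
  have h0 : F 0 = 1 := by
    have h00 : (0 : ℝ) ∈ Ico 0 T := ⟨le_rfl, ht.1.trans_lt ht.2⟩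
    have := coshDist_sub_one (a := a 0) (a₁ := a 0) (h 0 h00).1.ne' (h 0 h00).1.ne'
    simp only [F, ha, hc]
    rw [sub_eq_iff_eq_add.1 this]
    simp
  have hle := hanti (left_mem_Icc.2 ht.1) (right_mem_Icc.2 ht.1) ht.1
  exact eq_of_coshDist_le_one (h₁ t ht).1 (h t ht).1 (hle.trans h0.le)

/-- The solution runs along the geodesic from `(a₀, c₀)` to `(a', c')`. -/
theorem exists_isCoeffFlow (hs : 0 < s) (hc' : 0 < c') (hd' : c' * d' = 1 + a' ^ 2)
    (a₀ : ℝ) {c₀ : ℝ} (hc₀ : 0 < c₀) :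
    ∃ a c : ℝ → ℝ, a 0 = a₀ ∧ c 0 = c₀ ∧ IsCoeffFlow s a' c' d' (Ici 0) a c ∧
      Tendsto a atTop (𝓝 a') ∧ Tendsto c atTop (𝓝 c') := by
  set d₀ := (1 + a₀ ^ 2) / c₀ with hd₀
  have hcd₀ : c₀ * d₀ = 1 + a₀ ^ 2 := by rw [hd₀]; field_simp
  have hd : d' = (1 + a' ^ 2) / c' := by field_simp; linarith
  set g₀ := coshDist a' c' d' a₀ c₀ with hg₀
  have hg₀1 : 1 ≤ g₀ := by
    rw [hg₀, hd]
    exact one_le_coshDist hc₀ hc'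
  -- The ansatz J = (J₀ + uJ')/ρ has determinant 1 if ρ² = 1 + 2ug₀ + u². Then g = (g₀ + u)/ρ, and
  -- the flow becomes the linear system u' = 2sρ, ρ' = 2s(g₀ + u) with u(0) = 0, ρ(0) = 1.
  let ρ : ℝ → ℝ := fun t => Real.cosh (2 * s * t) + g₀ * Real.sinh (2 * s * t)
  let u : ℝ → ℝ := fun t => g₀ * (Real.cosh (2 * s * t) - 1) + Real.sinh (2 * s * t)
  have hsinh : ∀ t, 0 ≤ t → 0 ≤ Real.sinh (2 * s * t) := fun t ht =>
    Real.sinh_nonneg_iff.2 (by positivity)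
  have hρ : ∀ t, 0 ≤ t → 0 < ρ t := fun t ht =>
    add_pos_of_pos_of_nonneg (Real.cosh_pos _) (mul_nonneg (by linarith) (hsinh t ht))
  have hu : ∀ t, 0 ≤ t → 0 ≤ u t := fun t ht =>
    add_nonneg (mul_nonneg (by linarith) (sub_nonneg.2 (Real.one_le_cosh _))) (hsinh t ht)
  have hlin : ∀ t, HasDerivAt (fun t => 2 * s * t) (2 * s) t := fun t => by
    simpa using (hasDerivAt_id t).const_mul (2 * s)
  have hρ' : ∀ t, HasDerivAt ρ (2 * s * (g₀ + u t)) t := fun t => by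
    refine ((hlin t).cosh.fun_add ((hlin t).sinh.const_mul g₀)).congr_deriv ?_
    simp only [u]
    ring
  have hu' : ∀ t, HasDerivAt u (2 * s * ρ t) t := fun t => by
    refine ((((hlin t).cosh.sub_const 1).const_mul g₀).fun_add (hlin t).sinh).congr_deriv ?_
    simp only [ρ]
    ring
  have hρ2 : ∀ t, ρ t ^ 2 = 1 + 2 * u t * g₀ + u t ^ 2 := fun t => by
    simp only [ρ, u]
    linear_combination (1 - g₀ ^ 2) * Real.cosh_sq (2 * s * t)
  have hg : ∀ t, 0 ≤ t →
      coshDist a' c' d' ((a₀ + u t * a') / ρ t) ((c₀ + u t * c') / ρ t) = (g₀ + u t) / ρ t := by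
    intro t ht
    have h1 := (hρ t ht).ne'
    have h2 : c₀ + u t * c' ≠ 0 := by have := hu t ht; positivity
    have h3 : (1 + ((a₀ + u t * a') / ρ t) ^ 2) / ((c₀ + u t * c') / ρ t) =
        (d₀ + u t * d') / ρ t := by
      field_simp
      have hg2 : 2 * g₀ = c₀ * d' + d₀ * c' - 2 * a₀ * a' := by
        rw [hg₀, coshDist]; ring
      rw [hρ2 t]
      linear_combination u t * hg2 - hcd₀ - u t ^ 2 * hd'
    rw [coshDist, h3, hg₀, coshDist, ← hd₀]
    field_simp
    linear_combination 2 * u t * hd'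
  have hderiv : ∀ x₀ x' t, 0 ≤ t → HasDerivAt (fun t => (x₀ + u t * x') / ρ t)
      (2 * s * (x' - (g₀ + u t) / ρ t * ((x₀ + u t * x') / ρ t))) t := by
    intro x₀ x' t ht
    have h1 := (hρ t ht).ne'
    refine ((((hu' t).mul_const x').const_add x₀).fun_div (hρ' t) h1).congr_deriv ?_
    field_simp
  have hρtop : Tendsto ρ atTop atTop := by
    have h1 : Tendsto (fun t : ℝ => 2 * s * t) atTop atTop :=
      tendsto_id.const_mul_atTop (by positivity)
    have h2 : Tendsto (fun t : ℝ => Real.exp (2 * s * t) / 2) atTop atTop :=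
      (Real.tendsto_exp_atTop.comp h1).atTop_div_const two_pos
    refine tendsto_atTop_mono' _ ?_ h2
    filter_upwards [eventually_ge_atTop 0] with t ht
    have h3 : Real.exp (2 * s * t) / 2 ≤ Real.cosh (2 * s * t) := by
      rw [Real.cosh_eq]
      have := Real.exp_pos (-(2 * s * t))
      linarith
    exact h3.trans (le_add_of_nonneg_right (mul_nonneg (by linarith) (hsinh t ht)))
  have hinv : Tendsto (fun t => (ρ t)⁻¹) atTop (𝓝 0) := tendsto_inv_atTop_zero.comp hρtop
  have hratio : Tendsto (fun t => u t / ρ t) atTop (𝓝 1) := by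
    have h1 : Tendsto (fun t : ℝ => Real.exp (-(2 * s * t))) atTop (𝓝 0) :=
      Real.tendsto_exp_neg_atTop_nhds_zero.comp (tendsto_id.const_mul_atTop (by positivity))
    -- This uses u - ρ = (g₀ - 1) exp(-2st) - g₀, which stays bounded while ρ tends to infinity.
    have h2 := (((h1.const_mul (g₀ - 1)).sub_const g₀).mul hinv).const_add 1
    rw [mul_zero, add_zero] at h2
    refine h2.congr' ?_
    filter_upwards [eventually_ge_atTop 0] with t ht
    have h3 := (hρ t ht).ne'
    rw [← Real.cosh_sub_sinh]
    field_simp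
    simp only [ρ, u]
    ring
  have hlim : ∀ x₀ x', Tendsto (fun t => (x₀ + u t * x') / ρ t) atTop (𝓝 x') := by
    intro x₀ x'
    have := (hinv.const_mul x₀).add (hratio.mul_const x')
    rw [mul_zero, zero_add, one_mul] at this
    refine this.congr fun t => ?_
    ring
  have hinit : ∀ x₀ x', (x₀ + u 0 * x') / ρ 0 = x₀ := by
    intro x₀ x'
    simp [u, ρ]
  refine ⟨fun t => (a₀ + u t * a') / ρ t, fun t => (c₀ + u t * c') / ρ t, hinit _ _, hinit _ _,
    fun t ht => ⟨?_, ?_, ?_⟩, hlim _ _, hlim _ _⟩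
  · have := hu t ht
    have := hρ t ht
    positivity
  · rw [hg t ht]
    exact (hderiv a₀ a' t ht).hasDerivWithinAt
  · rw [hg t ht]
    exact (hderiv c₀ c' t ht).hasDerivWithinAt

end FlowEquation

/-! ### From the coefficient equations to the normalized torsion flow and back -/

section Flow

theorem ofReal_add_mul_inj {a c r₁ r₂ t₁ t₂ : ℝ} (hc : 0 < c)
    (h : (r₁ : ℂ) + (Complex.I - a) / c * t₁ = r₂ + (Complex.I - a) / c * t₂) :
    r₁ = r₂ ∧ t₁ = t₂ := by
  have hc' : (c : ℂ) ≠ 0 := by exact_mod_cast hc.ne'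
  field_simp at h
  have him := congrArg Complex.im h
  have hre := congrArg Complex.re h
  simp at him hre
  subst him
  refine ⟨?_, rfl⟩
  have : c * (r₁ - r₂) = 0 := by linarith
  have := (mul_eq_zero.1 this).resolve_left hc.ne'
  linarith

variable {M : Type*} [TopologicalSpace M] [ChartedSpace E3 M] [IsManifold (𝓡 3) ∞ M]

namespace IsReduced

variable {e : Fin 3 → OneForm M ℝ} {κ s p q a' c' d' : ℝ}

theorem coframe_torsionValue (H : IsReduced e κ s p q a' c' d') {a c : ℝ}
    (hc : 0 < c) (D : TanakaWebster (e 0) (homJ e a c)) {x : M} {w : TangentSpace (𝓡 3) x}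
    (h : D.IsTorsionValue x (dualFrame e 1 x) w) :
    e 1 x w = s * (a' - coshDist a' c' d' a c * a) ∧
      e 2 x w = s * (c' - coshDist a' c' d' a c * c) := by
  obtain ⟨s0, s1, s2⟩ := H.coframe_dualFrame_one x
  have h1 := H.typeForm_torsionValue hc D h
  rw [torsionCoeff_eq _ _ _ _ _ _ hc.ne', typeForm_apply, typeForm_apply, s0, s1, s2, h.1] at h1
  apply ofReal_add_mul_inj (a := a) hc
  simp at h1
  push_cast
  exact h1

theorem eq_of_isTorsionFree [Nonempty M] (H : IsReduced e κ s p q a' c' d') {a c : ℝ}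
    (hc : 0 < c) (h : IsTorsionFree (e 0) (homJ e a c)) : a = a' ∧ c = c' := by
  obtain ⟨D, hD⟩ := h
  obtain ⟨x⟩ := ‹Nonempty M›
  have h1 := H.A_mul_conj hc D x
  rw [hD, zero_mul, eq_comm] at h1
  have h2 := (mul_eq_zero.1 h1).resolve_right (H.θ1_dualFrame_one_ne_zero hc D x)
  rw [torsionCoeff_eq _ _ _ _ _ _ hc.ne'] at h2
  have hs := H.s_pos
  have hcp := H.c_pos
  have hdet := H.det
  set g := coshDist a' c' d' a c with hg
  obtain ⟨h3, h4⟩ := ofReal_add_mul_inj (a := a) (r₁ := s * (a' - g * a)) (r₂ := 0)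
    (t₁ := s * (c' - g * c)) (t₂ := 0) hc (by push_cast; simpa using h2)
  have h5 : a' = g * a := by
    have := (mul_eq_zero.1 h3).resolve_left hs.ne'
    linarith
  have h6 : c' = g * c := by
    have := (mul_eq_zero.1 h4).resolve_left hs.ne'
    linarith
  have hgpos : 0 < g := by
    rw [h6] at hcp
    exact pos_of_mul_pos_left hcp hc.le
  have hg2 : g * (2 * c) = c ^ 2 * d' + (1 + a ^ 2) * c' - 2 * a * a' * c := by
    rw [hg, coshDist]
    field_simp
  rw [h5, h6] at hg2 hdet
  -- Compare determinants in J' = gJ.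
  have hg3 : g ^ 2 = 1 := by
    have : c * (g ^ 2 - 1) = 0 := by
      linear_combination g * hg2 + c * hdet
    have := (mul_eq_zero.1 this).resolve_left hc.ne'
    linarith
  have hg4 : g = 1 := by nlinarith
  rw [hg4, one_mul] at h5 h6
  exact ⟨h5.symm, h6.symm⟩

theorem isTorsionFree (H : IsReduced e κ s p q a' c' d') :
    IsTorsionFree (e 0) (homJ e a' c') := by
  obtain ⟨D, hD, -⟩ := H.exists_tanakaWebster H.c_pos (a := a')
  refine ⟨D, fun x => ?_⟩
  have hd : (1 + a' ^ 2) / c' = d' := by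
    rw [← H.det]
    field_simp [H.c_pos.ne']
  have hg : coshDist a' c' d' a' c' = 1 := by
    rw [coshDist, hd]
    linear_combination H.det
  rw [hD, torsionCoeff_eq _ _ _ _ _ _ H.c_pos.ne', hg]
  simp

theorem isNormalizedTorsionFlow (H : IsReduced e κ s p q a' c' d') {a c : ℝ → ℝ} {S : Set ℝ}
    (h : IsCoeffFlow s a' c' d' S a c) :
    IsNormalizedTorsionFlow S (fun _ => e 0) (fun t => homJ e (a t) (c t)) := by
  intro t ht
  obtain ⟨hc, h1, h2⟩ := h t ht
  refine ⟨H.isPseudohermitian hc, ?_⟩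
  obtain ⟨D, hA, hW, m, hm, hθ⟩ := H.exists_tanakaWebster hc (a := a t)
  set g := coshDist a' c' d' (a t) (c t) with hg
  have h3 := hasDerivWithinAt_coeff hc hg h1 h2
  refine ⟨D, fun x v hv => ?_, s * g, ?_, fun x v => ?_⟩
  · set X₁ := dualFrame e 1 x
    set X₂ := dualFrame e 2 x
    obtain ⟨s0, s1, s2⟩ := H.coframe_dualFrame_one x
    obtain ⟨t0, t1, t2⟩ := H.coframe_dualFrame_two x
    -- The vector s(J' - gJ)v in the frame X₁, X₂.
    let w : TangentSpace (𝓡 3) x :=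
      (e 1 x v * (s * (a' - g * a t)) - e 2 x v * (s * (d' - g * ((1 + a t ^ 2) / c t)))) • X₁ +
      (e 1 x v * (s * (c' - g * c t)) - e 2 x v * (s * (a' - g * a t))) • X₂
    refine ⟨w, ⟨?_, ?_⟩, ?_⟩
    · simp only [w, map_add, map_smul, X₁, X₂, s0, t0, smul_zero, add_zero]
    · have k1 := torsionCoeff_eq s a' c' d' (a t) (c t) hc.ne'
      have k2 := torsionCoeff_mul_conj s a' c' d' (a t) (c t) hc.ne'
      rw [← hg] at k1 k2
      simp only [hA, hθ, smul_apply, smul_eq_mul, map_mul, typeForm_apply, w, map_add, map_smul,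
        X₁, X₂, s0, s1, s2, t0, t1, t2, hv, Complex.conj_ofReal, map_div₀, map_sub,
        Complex.conj_I]
      simp only [Complex.real_smul]
      push_cast
      linear_combination (-m * e 1 x v) * k1 - (m * e 2 x v) * k2
    · have h4 : HasDerivWithinAt
          (fun r => e 1 x v * a r - e 2 x v * ((1 + a r ^ 2) / c r)) _ S t :=
        (h1.const_mul (e 1 x v)).fun_sub (h3.const_mul (e 2 x v))
      have h5 : HasDerivWithinAt (fun r => e 1 x v * c r - e 2 x v * a r) _ S t :=
        (h2.const_mul (e 1 x v)).fun_sub (h1.const_mul (e 2 x v))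
      have key : ∀ (Y₁ Y₂ : E3), HasDerivWithinAt
          (fun r => (e 1 x v * a r - e 2 x v * ((1 + a r ^ 2) / c r)) • Y₁ +
            (e 1 x v * c r - e 2 x v * a r) • Y₂)
          ((2 : ℝ) • ((e 1 x v * (s * (a' - g * a t)) -
              e 2 x v * (s * (d' - g * ((1 + a t ^ 2) / c t)))) • Y₁ +
            (e 1 x v * (s * (c' - g * c t)) - e 2 x v * (s * (a' - g * a t))) • Y₂)) S t := by
        intro Y₁ Y₂
        refine ((h4.smul_const Y₁).fun_add (h5.smul_const Y₂)).congr_deriv ?_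
        module
      have hJ : (fun r => homJ e (a r) (c r) x v) = fun r =>
          (e 1 x v * a r - e 2 x v * ((1 + a r ^ 2) / c r)) • X₁ +
            (e 1 x v * c r - e 2 x v * a r) • X₂ := by
        funext r
        have : homJ e (a r) (c r) x v = e 1 x v • (a r • X₁ + c r • X₂) +
          e 2 x v • (-((1 + a r ^ 2) / c r) • X₁ - a r • X₂) := rfl
        rw [this]
        module
      rw [hJ]
      exact key X₁ X₂
  · have : (fun x => D.W x - s * g) = fun _ => 0 := by
      funext x
      rw [hW, sub_self]
    unfold IsMean
    rw [this]
    exact ⟨integrable_zero _ _ _, integral_zero _ _⟩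
  · rw [hW, sub_self, mul_zero, zero_mul]
    exact hasDerivWithinAt_const _ _ _

end IsReduced

/-- A nonzero constant is integrable only if the volume is finite, and then its integral is nonzero
because the volume is. -/
theorem IsMean.eq_zero_of_forall_sub_eq [Nonempty M] {θ : OneForm M ℝ} (hθ : IsContact θ)
    {W : M → ℝ} {m r : ℝ} (h : IsMean θ W m) (hr : ∀ x, W x - m = r) : r = 0 := by
  let _ : MeasurableSpace M := borel M
  obtain ⟨h1, h2⟩ := h
  simp only [hr] at h1 h2
  by_contra hne
  have hfin := ((integrable_const_iff_isFiniteMeasure hne).1 h1)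
  rw [integral_const, smul_eq_mul] at h2
  have h3 := (mul_eq_zero.1 h2).resolve_right hne
  -- The real-valued measure is 0 also when the volume is infinite; that case contradicts
  -- integrability.
  rw [Measure.real, ENNReal.toReal_eq_zero_iff] at h3
  rcases h3 with h3 | h3
  · exact contactVolume_ne_zero hθ (Measure.measure_univ_eq_zero.1 h3)
  · exact measure_ne_top _ _ h3

/-- The scale depends on time alone, so comparing its equation at different points makes W minus the
mean constant in space, hence zero. The value of W is not needed. -/
theorem scale_eq_one [Nonempty M] {θ : OneForm M ℝ}
    (hcof : ∀ x, ∃ v, θ x v = 1) {T : ℝ} {β : ℝ → ℝ} {J : ℝ → EndField M}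
    (hβ0 : β 0 = 1) (hβ : ∀ t ∈ Ico 0 T, 0 < β t)
    (h : IsNormalizedTorsionFlow (Ico 0 T) (fun t x => (β t) ^ 2 • θ x) J) {t : ℝ}
    (ht : t ∈ Ico 0 T) : β t = 1 := by
  have hder : ∀ r ∈ Ico 0 T, HasDerivWithinAt (fun r => β r ^ 2) 0 (Ico 0 T) r := by
    intro r hr
    obtain ⟨hP, D, -, m, hm, hD⟩ := h r hr
    have h1 : ∀ x, HasDerivWithinAt (fun r => β r ^ 2) (-2 * (D.W x - m) * β r ^ 2)
        (Ico 0 T) r := by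
      intro x
      obtain ⟨v, hv⟩ := hcof x
      have := hD x v
      simpa [hv] using this
    obtain ⟨x₀⟩ := ‹Nonempty M›
    have hun : UniqueDiffWithinAt ℝ (Ico 0 T) r := uniqueDiffOn_Ico 0 T r hr
    have h2 : ∀ x, D.W x - m = D.W x₀ - m := by
      intro x
      have h3 := hun.eq_deriv _ (h1 x) (h1 x₀)
      have h4 : β r ^ 2 ≠ 0 := (pow_pos (hβ r hr) 2).ne'
      have h5 := mul_right_cancel₀ h4 h3
      linarith
    have h6 := hm.eq_zero_of_forall_sub_eq hP.contact h2
    simpa [h6] using h1 x₀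
  have hsub : Icc 0 t ⊆ Ico 0 T := fun r hr => ⟨hr.1, hr.2.trans_lt ht.2⟩
  have hconst := constant_of_derivWithin_zero (f := fun r => β r ^ 2) (a := 0) (b := t)
    (fun r hr => ((hder r (hsub hr)).mono hsub).differentiableWithinAt)
    (fun r hr => ((hder r (hsub (Ico_subset_Icc_self hr))).mono hsub).derivWithin
      (uniqueDiffOn_Icc (hr.1.trans_lt hr.2) r (Ico_subset_Icc_self hr)))
    t (right_mem_Icc.2 ht.1)
  simp only [hβ0] at hconst
  nlinarith [hβ t ht]

namespace IsReduced

variable {e : Fin 3 → OneForm M ℝ} {κ s p q a' c' d' : ℝ}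

/-- Since JX₁ = aX₁ + cX₂, the flow equation on the single vector X₁ contains both coefficient
equations. -/
theorem isCoeffFlow [Nonempty M] (H : IsReduced e κ s p q a' c' d') {S : Set ℝ} {α γ : ℝ → ℝ}
    {θ : ℝ → OneForm M ℝ} (hθ : ∀ t ∈ S, θ t = e 0) (hγ : ∀ t ∈ S, 0 < γ t)
    (h : IsNormalizedTorsionFlow S θ (fun t => homJ e (α t) (γ t))) :
    IsCoeffFlow s a' c' d' S α γ := by
  intro t ht
  obtain ⟨-, D, hD, -⟩ := h t ht
  have hθt := hθ t ht
  generalize θ t = θt at *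
  subst hθt
  obtain ⟨x⟩ := ‹Nonempty M›
  obtain ⟨s0, s1, s2⟩ := H.coframe_dualFrame_one x
  obtain ⟨t0, t1, t2⟩ := H.coframe_dualFrame_two x
  obtain ⟨w, hw, hder⟩ := hD x (dualFrame e 1 x) s0
  obtain ⟨w1, w2⟩ := H.coframe_torsionValue (hγ t ht) D hw
  simp only [H.homJ_dualFrame_one] at hder
  have key : ∀ (L : E3 →L[ℝ] ℝ) (w : E3) (f : ℝ → E3), HasDerivWithinAt f ((2 : ℝ) • w) S t →
      HasDerivWithinAt (fun r => L (f r)) (2 * L w) S t := by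
    intro L w f hf
    exact (L.hasFDerivAt.comp_hasDerivWithinAt t hf).congr_deriv (by simp)
  have k1 := key (e 1 x) w _ hder
  have k2 := key (e 2 x) w _ hder
  refine ⟨hγ t ht, ?_, ?_⟩
  · have : (fun r => e 1 x (α r • dualFrame e 1 x + γ r • dualFrame e 2 x)) = α := by
      funext r
      rw [map_add, map_smul, map_smul, s1, t1]
      simp
    refine (this ▸ k1).congr_deriv ?_
    rw [mul_assoc, ← w1]
    rfl
  · have : (fun r => e 2 x (α r • dualFrame e 1 x + γ r • dualFrame e 2 x)) = γ := by
      funext r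
      rw [map_add, map_smul, map_smul, s2, t2]
      simp
    refine (this ▸ k2).congr_deriv ?_
    rw [mul_assoc, ← w2]
    rfl

theorem flowConverges [Nonempty M] (H : IsReduced e κ s p q a' c' d') (a₀ : ℝ) {c₀ : ℝ}
    (hc₀ : 0 < c₀) : FlowConverges e a₀ c₀ a' c' := by
  obtain ⟨a, c, ha0, hc0, hflow, hla, hlc⟩ := exists_isCoeffFlow H.s_pos H.c_pos H.det a₀ hc₀
  refine ⟨a, c, ha0, hc0, fun t ht => (hflow t ht).1, H.isNormalizedTorsionFlow hflow, hla, hlc, ?_⟩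
  intro T α β γ hα hβ hγ hpos h t ht
  have hβ1 : ∀ r ∈ Ico 0 T, β r = 1 := fun r hr =>
    scale_eq_one (fun x => ⟨reeb e p q x, (H.coframe_reeb x).1⟩) hβ (fun r hr => (hpos r hr).1) h hr
  have hθ : ∀ r ∈ Ico 0 T, (fun x => (β r) ^ 2 • e 0 x) = e 0 := by
    intro r hr
    funext x
    rw [hβ1 r hr, one_pow, one_smul]
  have hflow' := H.isCoeffFlow hθ (fun r hr => (hpos r hr).2) h
  obtain ⟨h1, h2⟩ := IsCoeffFlow.eq H.s_pos H.c_pos H.det (hflow.mono Ico_subset_Ici_self) hflow'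
    (hα.trans ha0.symm) (hγ.trans hc0.symm) ht
  exact ⟨h1, hβ1 t ht, h2⟩

end IsReduced

end Flow

/-! ### Structure constants of su(2) as a Gram matrix -/

section LieAlgebra

theorem su2_coe_bracket (A B : su2) :
    ((⁅A, B⁆ : su2) : Matrix (Fin 2) (Fin 2) ℂ) = A.1 * B.1 - B.1 * A.1 :=
  rfl

theorem matrix_mem_su2 (v : Fin 3 → ℝ) :
    !![Complex.I * v 0, v 1 + Complex.I * v 2; -v 1 + Complex.I * v 2, -(Complex.I * v 0)] ∈ su2 := by
  refine ⟨?_, ?_⟩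
  · ext i j
    fin_cases i <;> fin_cases j <;> simp [Matrix.conjTranspose_apply, add_comm]
  · simp [Matrix.trace_fin_two]

/-- The isomorphism of `ℝ³` with twice the cross product and `su(2)`. -/
noncomputable def su2Equiv : (Fin 3 → ℝ) ≃ₗ[ℝ] su2 where
  toFun v := ⟨_, matrix_mem_su2 v⟩
  map_add' v w := by
    apply Subtype.ext
    ext i j
    fin_cases i <;> fin_cases j <;> simp <;> ring
  map_smul' r v := by
    apply Subtype.ext
    ext i j
    fin_cases i <;> fin_cases j <;> simp <;> ring
  invFun A := ![(A.1 0 0).im, (A.1 0 1).re, (A.1 0 1).im]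
  left_inv v := by
    ext i
    fin_cases i <;> simp
  right_inv A := by
    obtain ⟨A, hA, hA'⟩ := A
    apply Subtype.ext
    have h00 := congrFun (congrFun hA 0) 0
    have h01 := congrFun (congrFun hA 1) 0
    rw [Matrix.trace_fin_two] at hA'
    simp only [Matrix.conjTranspose_apply, Matrix.neg_apply, Complex.ext_iff, Complex.star_def,
      Complex.conj_re, Complex.conj_im, Complex.neg_re, Complex.neg_im] at h00 h01
    simp only [Complex.ext_iff, Complex.add_re, Complex.add_im, Complex.zero_re,
      Complex.zero_im] at hA'
    obtain ⟨h1, -⟩ := h00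
    obtain ⟨h2, h3⟩ := h01
    obtain ⟨h4, h5⟩ := hA'
    ext i j
    fin_cases i <;> fin_cases j <;> simp [Complex.ext_iff] <;>
      (try constructor) <;> linarith

theorem su2Equiv_bracket (v w : Fin 3 → ℝ) : ⁅su2Equiv v, su2Equiv w⁆ =
    su2Equiv ![2 * (v 1 * w 2 - v 2 * w 1), 2 * (v 2 * w 0 - v 0 * w 2),
      2 * (v 0 * w 1 - v 1 * w 0)] := by
  apply Subtype.ext
  rw [su2_coe_bracket]
  ext i j
  fin_cases i <;> fin_cases j <;>
    simp [su2Equiv, Complex.ext_iff] <;> ring_nf <;> exact ⟨trivial, trivial⟩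

theorem LieAlgebraIsSU2.exists_vectors {k : Fin 3 → Fin 3 → Fin 3 → ℝ} (h : LieAlgebraIsSU2 k) :
    ∃ x : Fin 3 → Fin 3 → ℝ, Matrix.det (Matrix.of x) ≠ 0 ∧ ∀ j l : Fin 3, j < l →
      ![2 * (x j 1 * x l 2 - x j 2 * x l 1), 2 * (x j 2 * x l 0 - x j 0 * x l 2),
        2 * (x j 0 * x l 1 - x j 1 * x l 0)] = -∑ i, k i j l • x i := by
  obtain ⟨X, hX⟩ := h
  refine ⟨fun i => su2Equiv.symm (X i), ?_, fun j l hjl => ?_⟩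
  · have hli : LinearIndependent ℝ (fun i => su2Equiv.symm (X i)) :=
      X.linearIndependent.map' su2Equiv.symm.toLinearMap su2Equiv.symm.ker
    have := (Matrix.linearIndependent_rows_iff_isUnit
      (A := Matrix.of fun i => su2Equiv.symm (X i))).1 hli
    exact ((Matrix.isUnit_iff_isUnit_det _).1 this).ne_zero
  · apply su2Equiv.injective
    rw [← su2Equiv_bracket, LinearEquiv.apply_symm_apply, LinearEquiv.apply_symm_apply, hX j l hjl]
    simp

-- Let a, b, c be the basis in ℝ³, D its determinant, and u = b×c, v = c×a, w = a×b. Pairing the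
-- brackets with u, v, w shows that each structure constant times D is ±2 times an entry of the Gram
-- matrix of u, v, w. Its symmetry gives the equalities, and `hk` forces D < 0. The first inequality
-- is a 2×2 Gram minor, |w×u|² = D²|b|². The second comes from the full Gram determinant D⁴: the
-- expression equals -8D.
set_option maxHeartbeats 1000000 in
theorem LieAlgebraIsSU2.coeffs {k : Fin 3 → Fin 3 → Fin 3 → ℝ} (h : LieAlgebraIsSU2 k)
    (hk : 0 < k 0 1 2) :
    k 1 1 2 = -k 0 0 2 ∧ k 2 1 2 = k 0 0 1 ∧ k 2 0 2 = -k 1 0 1 ∧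
      0 < k 0 1 2 * k 2 0 1 - k 0 0 1 ^ 2 ∧
      0 < k 0 1 2 * (-k 1 0 2 * k 2 0 1 - k 1 0 1 ^ 2) +
        k 0 0 2 * (-k 0 0 2 * k 2 0 1 - k 1 0 1 * k 0 0 1) +
        k 0 0 1 * (-k 0 0 2 * k 1 0 1 + k 1 0 2 * k 0 0 1) := by
  obtain ⟨x, hdet, hx⟩ := h.exists_vectors
  rw [Matrix.det_fin_three] at hdet
  simp only [Matrix.of_apply] at hdet
  have h01 := hx 0 1 (by decide)
  have h02 := hx 0 2 (by decide)
  have h12 := hx 1 2 (by decide)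
  simp only [Fin.sum_univ_three, funext_iff, Fin.forall_fin_succ] at h01 h02 h12
  simp at h01 h02 h12
  generalize x 0 0 = a0, x 0 1 = a1, x 0 2 = a2, x 1 0 = b0, x 1 1 = b1, x 1 2 = b2,
    x 2 0 = c0, x 2 1 = c1, x 2 2 = c2 at *
  obtain ⟨p0, p1, p2⟩ := h01
  obtain ⟨q0, q1, q2⟩ := h02
  obtain ⟨r0, r1, r2⟩ := h12
  obtain ⟨D, hD⟩ : ∃ D, D = a0 * b1 * c2 - a0 * b2 * c1 - a1 * b0 * c2 + a1 * b2 * c0 +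
    a2 * b0 * c1 - a2 * b1 * c0 := ⟨_, rfl⟩
  rw [← hD] at hdet
  obtain ⟨u0, hu0⟩ : ∃ u, u = b1 * c2 - b2 * c1 := ⟨_, rfl⟩
  obtain ⟨u1, hu1⟩ : ∃ u, u = b2 * c0 - b0 * c2 := ⟨_, rfl⟩
  obtain ⟨u2, hu2⟩ : ∃ u, u = b0 * c1 - b1 * c0 := ⟨_, rfl⟩
  obtain ⟨v0, hv0⟩ : ∃ u, u = c1 * a2 - c2 * a1 := ⟨_, rfl⟩
  obtain ⟨v1, hv1⟩ : ∃ u, u = c2 * a0 - c0 * a2 := ⟨_, rfl⟩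
  obtain ⟨v2, hv2⟩ : ∃ u, u = c0 * a1 - c1 * a0 := ⟨_, rfl⟩
  obtain ⟨w0, hw0⟩ : ∃ u, u = a1 * b2 - a2 * b1 := ⟨_, rfl⟩
  obtain ⟨w1, hw1⟩ : ∃ u, u = a2 * b0 - a0 * b2 := ⟨_, rfl⟩
  obtain ⟨w2, hw2⟩ : ∃ u, u = a0 * b1 - a1 * b0 := ⟨_, rfl⟩
  have k012 : k 0 1 2 * D = -2 * (u0 * u0 + u1 * u1 + u2 * u2) := by
    rw [hD, hu0, hu1, hu2]
    linear_combination (b1 * c2 - b2 * c1) * r0 + (b2 * c0 - b0 * c2) * r1 +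
      (b0 * c1 - b1 * c0) * r2
  have k112 : k 1 1 2 * D = -2 * (u0 * v0 + u1 * v1 + u2 * v2) := by
    rw [hD, hu0, hu1, hu2, hv0, hv1, hv2]
    linear_combination (c1 * a2 - c2 * a1) * r0 + (c2 * a0 - c0 * a2) * r1 +
      (c0 * a1 - c1 * a0) * r2
  have k212 : k 2 1 2 * D = -2 * (u0 * w0 + u1 * w1 + u2 * w2) := by
    rw [hD, hu0, hu1, hu2, hw0, hw1, hw2]
    linear_combination (a1 * b2 - a2 * b1) * r0 + (a2 * b0 - a0 * b2) * r1 +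
      (a0 * b1 - a1 * b0) * r2
  have k002 : k 0 0 2 * D = 2 * (u0 * v0 + u1 * v1 + u2 * v2) := by
    rw [hD, hu0, hu1, hu2, hv0, hv1, hv2]
    linear_combination (b1 * c2 - b2 * c1) * q0 + (b2 * c0 - b0 * c2) * q1 +
      (b0 * c1 - b1 * c0) * q2
  have k102 : k 1 0 2 * D = 2 * (v0 * v0 + v1 * v1 + v2 * v2) := by
    rw [hD, hv0, hv1, hv2]
    linear_combination (c1 * a2 - c2 * a1) * q0 + (c2 * a0 - c0 * a2) * q1 +
      (c0 * a1 - c1 * a0) * q2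
  have k202 : k 2 0 2 * D = 2 * (v0 * w0 + v1 * w1 + v2 * w2) := by
    rw [hD, hv0, hv1, hv2, hw0, hw1, hw2]
    linear_combination (a1 * b2 - a2 * b1) * q0 + (a2 * b0 - a0 * b2) * q1 +
      (a0 * b1 - a1 * b0) * q2
  have k001 : k 0 0 1 * D = -2 * (u0 * w0 + u1 * w1 + u2 * w2) := by
    rw [hD, hu0, hu1, hu2, hw0, hw1, hw2]
    linear_combination (b1 * c2 - b2 * c1) * p0 + (b2 * c0 - b0 * c2) * p1 +
      (b0 * c1 - b1 * c0) * p2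
  have k101 : k 1 0 1 * D = -2 * (v0 * w0 + v1 * w1 + v2 * w2) := by
    rw [hD, hv0, hv1, hv2, hw0, hw1, hw2]
    linear_combination (c1 * a2 - c2 * a1) * p0 + (c2 * a0 - c0 * a2) * p1 +
      (c0 * a1 - c1 * a0) * p2
  have k201 : k 2 0 1 * D = -2 * (w0 * w0 + w1 * w1 + w2 * w2) := by
    rw [hD, hw0, hw1, hw2]
    linear_combination (a1 * b2 - a2 * b1) * p0 + (a2 * b0 - a0 * b2) * p1 +
      (a0 * b1 - a1 * b0) * p2
  have hDneg : D < 0 := by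
    refine lt_of_le_of_ne ?_ hdet
    by_contra hpos
    have := mul_pos hk (not_le.1 hpos)
    linarith [mul_self_nonneg u0, mul_self_nonneg u1, mul_self_nonneg u2]
  have hdety : u0 * (v1 * w2 - v2 * w1) - u1 * (v0 * w2 - v2 * w0) +
      u2 * (v0 * w1 - v1 * w0) = D ^ 2 := by
    rw [hD, hu0, hu1, hu2, hv0, hv1, hv2, hw0, hw1, hw2]
    ring
  refine ⟨?_, ?_, ?_, ?_, ?_⟩
  · exact mul_right_cancel₀ hdet (by linear_combination k112 + k002)
  · exact mul_right_cancel₀ hdet (by linear_combination k212 - k001)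
  · exact mul_right_cancel₀ hdet (by linear_combination k202 + k101)
  · have hcross : (u0 * u0 + u1 * u1 + u2 * u2) * (w0 * w0 + w1 * w1 + w2 * w2) -
        (u0 * w0 + u1 * w1 + u2 * w2) ^ 2 = D ^ 2 * (b0 ^ 2 + b1 ^ 2 + b2 ^ 2) := by
      have e0 : w1 * u2 - w2 * u1 = D * b0 := by
        rw [hD, hu1, hu2, hw1, hw2]; ring
      have e1 : w2 * u0 - w0 * u2 = D * b1 := by
        rw [hD, hu0, hu2, hw0, hw2]; ring
      have e2 : w0 * u1 - w1 * u0 = D * b2 := by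
        rw [hD, hu0, hu1, hw0, hw1]; ring
      linear_combination (w1 * u2 - w2 * u1 + D * b0) * e0 + (w2 * u0 - w0 * u2 + D * b1) * e1 +
        (w0 * u1 - w1 * u0 + D * b2) * e2
    have hb : 0 < b0 ^ 2 + b1 ^ 2 + b2 ^ 2 := by
      by_contra hn
      have s0 := sq_nonneg b0
      have s1 := sq_nonneg b1
      have s2 := sq_nonneg b2
      have h0 : b0 = 0 := pow_eq_zero_iff two_ne_zero |>.1 (le_antisymm (by linarith) s0)
      have h1 : b1 = 0 := pow_eq_zero_iff two_ne_zero |>.1 (le_antisymm (by linarith) s1)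
      have h2 : b2 = 0 := pow_eq_zero_iff two_ne_zero |>.1 (le_antisymm (by linarith) s2)
      apply hdet
      rw [hD, h0, h1, h2]
      ring
    have hkey : (k 0 1 2 * k 2 0 1 - k 0 0 1 ^ 2) * D ^ 2 =
        4 * (D ^ 2 * (b0 ^ 2 + b1 ^ 2 + b2 ^ 2)) := by
      rw [← hcross]
      linear_combination k 2 0 1 * D * k012 - 2 * (u0 * u0 + u1 * u1 + u2 * u2) * k201 -
        (k 0 0 1 * D - 2 * (u0 * w0 + u1 * w1 + u2 * w2)) * k001
    have hD2 : 0 < D ^ 2 := by positivity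
    exact pos_of_mul_pos_left (hkey ▸ by positivity) hD2.le
  · set N := k 0 1 2 * (-k 1 0 2 * k 2 0 1 - k 1 0 1 ^ 2) +
      k 0 0 2 * (-k 0 0 2 * k 2 0 1 - k 1 0 1 * k 0 0 1) +
      k 0 0 1 * (-k 0 0 2 * k 1 0 1 + k 1 0 2 * k 0 0 1) with hN
    have hkey : N * D ^ 3 = -8 * D * D ^ 3 := by
      have : N * D ^ 3 =
          k 0 1 2 * D * (-(k 1 0 2 * D) * (k 2 0 1 * D) - (k 1 0 1 * D) ^ 2) +
          k 0 0 2 * D * (-(k 0 0 2 * D) * (k 2 0 1 * D) - k 1 0 1 * D * (k 0 0 1 * D)) +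
          k 0 0 1 * D * (-(k 0 0 2 * D) * (k 1 0 1 * D) + k 1 0 2 * D * (k 0 0 1 * D)) := by
        rw [hN]; ring
      rw [this, k012, k102, k201, k101, k002, k001]
      linear_combination (-8) * (u0 * (v1 * w2 - v2 * w1) - u1 * (v0 * w2 - v2 * w0) +
      u2 * (v0 * w1 - v1 * w0) + D ^ 2) * hdety
    have := mul_right_cancel₀ (pow_ne_zero 3 hdet) hkey
    rw [this]
    linarith

/-- The structure coefficients of the coframe of `SU(2)` given by vectors `P 0, P 1, P 2`. -/
theorem lieAlgebraIsSU2_of_gram {k : Fin 3 → Fin 3 → Fin 3 → ℝ} {P : Fin 3 → Fin 3 → ℝ} {D : ℝ}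
    (hD : D = P 0 0 * (P 1 1 * P 2 2 - P 1 2 * P 2 1) + P 0 1 * (P 1 2 * P 2 0 - P 1 0 * P 2 2)
      + P 0 2 * (P 1 0 * P 2 1 - P 1 1 * P 2 0)) (hD0 : D ≠ 0)
    (h12 : ∀ i, k i 1 2 = 2 * (P i 0 * P 0 0 + P i 1 * P 0 1 + P i 2 * P 0 2) / D)
    (h01 : ∀ i, k i 0 1 = 2 * (P i 0 * P 2 0 + P i 1 * P 2 1 + P i 2 * P 2 2) / D)
    (h02 : ∀ i, k i 0 2 = -(2 * (P i 0 * P 1 0 + P i 1 * P 1 1 + P i 2 * P 1 2) / D)) :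
    LieAlgebraIsSU2 k := by
  -- Minus the dual basis of P, with indices modulo 3. The cross product of y (i+1) and y (i+2) is P
  -- i / D, and expanding P i in the dual basis produces the Gram matrix.
  let y : Fin 3 → Fin 3 → ℝ := fun i =>
    ![-(P (i + 1) 1 * P (i + 2) 2 - P (i + 1) 2 * P (i + 2) 1) / D,
      -(P (i + 1) 2 * P (i + 2) 0 - P (i + 1) 0 * P (i + 2) 2) / D,
      -(P (i + 1) 0 * P (i + 2) 1 - P (i + 1) 1 * P (i + 2) 0) / D]
  have hdet : Matrix.det (Matrix.of y) = -1 / D := by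
    rw [Matrix.det_fin_three]
    simp [y]
    field_simp
    rw [hD]
    ring
  have hli : LinearIndependent ℝ y := by
    refine (Matrix.linearIndependent_rows_iff_isUnit (A := Matrix.of y)).2 ?_
    rw [Matrix.isUnit_iff_isUnit_det, hdet]
    exact (div_ne_zero (by norm_num) hD0).isUnit
  refine ⟨(basisOfLinearIndependentOfCardEqFinrank hli (by simp)).map su2Equiv, fun j l hjl => ?_⟩
  simp only [Module.Basis.map_apply, coe_basisOfLinearIndependentOfCardEqFinrank, su2Equiv_bracket,
    ← map_smul, ← map_sum, ← map_neg]
  congr 1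
  fin_cases j <;> fin_cases l <;> simp at hjl
  all_goals
    ext i
    simp only [Fin.reduceFinMk, Fin.zero_eta, Fin.mk_one, Fin.sum_univ_three, h01, h02, h12]
    fin_cases i <;> simp [y] <;> ring

end LieAlgebra

/-! ### Reduction of the structure equations for su(2) -/

section Reduction

variable {M : Type*} [TopologicalSpace M] [ChartedSpace E3 M]

theorem sum_Ioi_wedge {V : Type*} (c : Fin 3 → Fin 3 → ℝ) (f : Fin 3 → V → ℝ) (u v : V) :
    ∑ j, ∑ l ∈ Finset.Ioi j, c j l * wedge (f j) (f l) u v =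
      c 0 1 * wedge (f 0) (f 1) u v + c 0 2 * wedge (f 0) (f 2) u v +
        c 1 2 * wedge (f 1) (f 2) u v := by
  have h0 : Finset.Ioi (0 : Fin 3) = {1, 2} := by decide
  have h1 : Finset.Ioi (1 : Fin 3) = {2} := by decide
  have h2 : Finset.Ioi (2 : Fin 3) = ∅ := by decide
  rw [Fin.sum_univ_three, h0, h1, h2]
  simp

/-- By `coeffs` the matrix with rows (k i 1 2, -k i 0 2, k i 0 1) is symmetric, with determinant N.
The choice of p, q completes the square in de⁰, which leaves the Schur complement of k 0 1 2. Its
determinant is N / k 0 1 2 = s², so division by s normalizes it to cd - a² = 1. -/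
theorem IsHomogeneousContact.exists_isReduced {e : Fin 3 → OneForm M ℝ}
    {k : Fin 3 → Fin 3 → Fin 3 → ℝ} (h : IsHomogeneousContact e k) (hk : 0 < k 0 1 2)
    (hsu : LieAlgebraIsSU2 k) : ∃ s p q a c d, IsReduced e (k 0 1 2) s p q a c d := by
  obtain ⟨e1, e2, e3, hpos, hdet⟩ := hsu.coeffs hk
  set N := k 0 1 2 * (-k 1 0 2 * k 2 0 1 - k 1 0 1 ^ 2) +
        k 0 0 2 * (-k 0 0 2 * k 2 0 1 - k 1 0 1 * k 0 0 1) +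
        k 0 0 1 * (-k 0 0 2 * k 1 0 1 + k 1 0 2 * k 0 0 1) with hN
  have hs : 0 < √(N / k 0 1 2) := Real.sqrt_pos.2 (by positivity)
  have hs2 : √(N / k 0 1 2) ^ 2 = N / k 0 1 2 := Real.sq_sqrt (by positivity)
  set s := √(N / k 0 1 2)
  refine ⟨s, -k 0 0 2 / k 0 1 2, k 0 0 1 / k 0 1 2,
    (k 1 0 1 + k 0 0 2 * k 0 0 1 / k 0 1 2) / s, (k 2 0 1 - k 0 0 1 ^ 2 / k 0 1 2) / s,
    (-k 1 0 2 - k 0 0 2 ^ 2 / k 0 1 2) / s, ?_⟩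
  have hd : ∀ i x u v, extD (e i) x u v = k i 0 1 * wedge (e 0 x) (e 1 x) u v +
      k i 0 2 * wedge (e 0 x) (e 2 x) u v + k i 1 2 * wedge (e 1 x) (e 2 x) u v := by
    intro i x u v
    rw [h.structure_eq]
    exact sum_Ioi_wedge (k i) (fun j => e j x) u v
  refine ⟨h.smooth, h.basis, h.contact, hk, hs, ?_, ?_, ?_, ?_, ?_⟩
  · refine div_pos ?_ hs
    have : k 2 0 1 - k 0 0 1 ^ 2 / k 0 1 2 = (k 0 1 2 * k 2 0 1 - k 0 0 1 ^ 2) / k 0 1 2 := by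
      field_simp
    rw [this]
    positivity
  · have h1 : s ^ 2 * k 0 1 2 = N := by rw [hs2]; field_simp
    field_simp
    rw [mul_comm] at h1
    linear_combination (-k 0 1 2) * h1 - k 0 1 2 * hN
  · intro x u v
    rw [hd]
    simp only [wedge]
    field_simp
    ring
  · intro x u v
    rw [hd, hd, e1]
    simp only [wedge]
    field_simp
    ring
  · intro x u v
    rw [hd, hd, e2, e3]
    simp only [wedge]
    field_simp
    ring

end Reduction

/-! ### Invariant forms on the sphere of unit quaternions -/

section Sphere

/-- The inverse of the preferred chart at `x`, as a map to the quaternions. -/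
noncomputable def sphereParam (x : S3) (y : E3) : ℍ[ℝ] := ((extChartAt (𝓡 3) x).symm y : S3)

theorem contDiffOn_sphereParam (x : S3) :
    ContDiffOn ℝ ∞ (sphereParam x) (extChartAt (𝓡 3) x).target := by
  rw [← contMDiffOn_iff_contDiffOn]
  exact (contMDiff_coe_sphere (E := ℍ[ℝ]) (n := 3) (m := ∞)).comp_contMDiffOn
    (contMDiffOn_extChartAt_symm x)

theorem fderiv_sphereParam (x : S3) {y : E3} (hy : y ∈ (extChartAt (𝓡 3) x).target) (v : E3) :
    fderiv ℝ (sphereParam x) y v = tangentIncl ((extChartAt (𝓡 3) x).symm y)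
      (mfderiv 𝓘(ℝ, E3) (𝓡 3) (extChartAt (𝓡 3) x).symm y v) := by
  have h1 : MDifferentiableAt (𝓡 3) 𝓘(ℝ, ℍ[ℝ]) (fun y : S3 => (y : ℍ[ℝ]))
      ((extChartAt (𝓡 3) x).symm y) :=
    (contMDiff_coe_sphere (E := ℍ[ℝ]) (n := 3) (m := ∞)).mdifferentiableAt (by simp)
  have h2 : MDifferentiableAt 𝓘(ℝ, E3) (𝓡 3) (extChartAt (𝓡 3) x).symm y :=
    ((contMDiffOn_extChartAt_symm (n := ∞) x).contMDiffAt
      ((isOpen_extChartAt_target x).mem_nhds hy)).mdifferentiableAt (by simp)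
  have h3 := mfderiv_comp y h1 h2
  rw [← mfderiv_eq_fderiv]
  exact congrArg (fun L => L v) h3

theorem fderiv_sphereParam_self (x : S3) (v : E3) :
    fderiv ℝ (sphereParam x) (extChartAt (𝓡 3) x x) v = tangentIncl x v := by
  rw [fderiv_sphereParam x (mem_extChartAt_target x)]
  have h := mfderivWithin_range_extChartAt_symm (I := 𝓡 3) (x := x)
  simp only [modelWithCornersSelf_coe, range_id, mfderivWithin_univ] at h
  rw [h, extChartAt_to_inv]
  rfl

theorem chartForm_invForm (p : ℍ[ℝ]) (x : S3) {y : E3} (hy : y ∈ (extChartAt (𝓡 3) x).target) :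
    chartForm (invForm p) x y =
      (innerSL ℝ (p * sphereParam x y)).comp (fderiv ℝ (sphereParam x) y) := by
  refine ContinuousLinearMap.ext fun v => ?_
  rw [ContinuousLinearMap.comp_apply, fderiv_sphereParam x hy]
  rfl

theorem smoothForm_invForm (p : ℍ[ℝ]) : SmoothForm (invForm p) := by
  intro x
  have h1 := contDiffOn_sphereParam x
  have h2 : ContDiffOn ℝ ∞ (fderiv ℝ (sphereParam x)) (extChartAt (𝓡 3) x).target :=
    h1.fderiv_of_isOpen (isOpen_extChartAt_target x) (by simp)
  refine ContDiffOn.congr ?_ fun y hy => chartForm_invForm p x hy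
  refine ContDiffOn.clm_comp ?_ h2
  exact (innerSL ℝ).contDiff.comp_contDiffOn (contDiffOn_const.mul h1)

theorem inner_imag_mul_comm {p : ℍ[ℝ]} (hp : p.re = 0) (u v : ℍ[ℝ]) :
    ⟪p * v, u⟫_ℝ = -⟪p * u, v⟫_ℝ := by
  simp [Quaternion.inner_def, hp]
  ring

/-- In a parametrization F the form is ⟨pF, dF⟩. The second derivative of F is symmetric and
cancels; the rest is ⟨p u, v⟩ antisymmetrized, and p imaginary makes this pairing already skew,
whence the factor 2. -/
theorem extD_invForm {p : ℍ[ℝ]} (hp : p.re = 0) (x : S3) (u v : TangentSpace (𝓡 3) x) :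
    extD (invForm p) x u v = 2 * ⟪p * tangentIncl x u, tangentIncl x v⟫_ℝ := by
  set y₀ := extChartAt (𝓡 3) x x
  have hcd : ContDiffAt ℝ ∞ (sphereParam x) y₀ :=
    (contDiffOn_sphereParam x).contDiffAt (extChartAt_target_mem_nhds x)
  have hd1 : DifferentiableAt ℝ (sphereParam x) y₀ := hcd.differentiableAt (by simp)
  have hd2 : DifferentiableAt ℝ (fderiv ℝ (sphereParam x)) y₀ :=
    (hcd.fderiv_right (m := 1) (by norm_cast)).differentiableAt one_ne_zero
  have hsymm : IsSymmSndFDerivAt ℝ (sphereParam x) y₀ :=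
    hcd.isSymmSndFDerivAt (by
      rw [minSmoothness_of_isRCLikeNormedField]
      exact WithTop.coe_le_coe.2 (le_top : (2 : ℕ∞) ≤ ⊤))
  have hd0 := (smoothForm_invForm p).differentiableAt x
  have key : ∀ u v : E3, fderiv ℝ (chartForm (invForm p) x) y₀ u v =
      ⟪p * sphereParam x y₀, fderiv ℝ (fderiv ℝ (sphereParam x)) y₀ u v⟫_ℝ +
      ⟪p * tangentIncl x u, tangentIncl x v⟫_ℝ := by
    intro u v
    have h1 : HasFDerivAt (fun y => chartForm (invForm p) x y v) _ y₀ :=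
      hd0.hasFDerivAt.clm_apply (hasFDerivAt_const v y₀)
    have h2 : HasFDerivAt
        (fun y => ⟪p * sphereParam x y, fderiv ℝ (sphereParam x) y v⟫_ℝ) _ y₀ :=
      (hd1.hasFDerivAt.const_mul p).inner ℝ (hd2.hasFDerivAt.clm_apply (hasFDerivAt_const v y₀))
    have h3 : (fun y => chartForm (invForm p) x y v) =ᶠ[𝓝 y₀]
        fun y => ⟪p * sphereParam x y, fderiv ℝ (sphereParam x) y v⟫_ℝ := by
      filter_upwards [extChartAt_target_mem_nhds x] with y hy
      rw [chartForm_invForm p x hy]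
      rfl
    have h4 := congrArg (fun L => L u) (h1.unique (h2.congr_of_eventuallyEq h3))
    simp at h4
    rw [fderiv_sphereParam_self, fderiv_sphereParam_self] at h4
    exact h4
  rw [extD_eq_flatD]
  have : ∀ u v : E3, flatD (chartForm (invForm p) x) y₀ u v =
      2 * ⟪p * tangentIncl x u, tangentIncl x v⟫_ℝ := by
    intro u v
    rw [flatD, key, key, hsymm.eq u v, inner_imag_mul_comm hp (tangentIncl x u)]
    ring
  exact this u v

theorem tangentIncl_injective (z : S3) : Function.Injective (tangentIncl z) :=
  injective_mvfderiv_subtypeVal_sphere (E := ℍ[ℝ]) (n := 3) z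

theorem inner_tangentIncl (z : S3) (v : TangentSpace (𝓡 3) z) :
    ⟪(z : ℍ[ℝ]), tangentIncl z v⟫_ℝ = 0 := by
  have h := range_mvfderiv_subtypeVal (E := ℍ[ℝ]) (n := 3) z
  have h1 : tangentIncl z v ∈ (ℝ ∙ (z : ℍ[ℝ]))ᗮ := by
    rw [← h]
    exact ⟨v, rfl⟩
  exact Submodule.mem_orthogonal_singleton_iff_inner_right.1 h1

theorem exists_tangentIncl_eq (z : S3) {w : ℍ[ℝ]} (hw : ⟪(z : ℍ[ℝ]), w⟫_ℝ = 0) :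
    ∃ v, tangentIncl z v = w := by
  have h := range_mvfderiv_subtypeVal (E := ℍ[ℝ]) (n := 3) z
  have h1 : w ∈ (ℝ ∙ (z : ℍ[ℝ]))ᗮ := Submodule.mem_orthogonal_singleton_iff_inner_right.2 hw
  rw [← h] at h1
  exact h1

theorem invForm_apply (p : ℍ[ℝ]) (z : S3) (v : TangentSpace (𝓡 3) z) :
    invForm p z v = ⟪p * z, tangentIncl z v⟫_ℝ := rfl

theorem star_mul_self_sphere (z : S3) : star (z : ℍ[ℝ]) * z = 1 := by
  rw [Quaternion.star_mul_self, Quaternion.normSq_eq_norm_mul_self]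
  simp

theorem inner_mul_sphere (z : S3) (a b : ℍ[ℝ]) : ⟪a * z, b * z⟫_ℝ = ⟪a, b⟫_ℝ := by
  rw [Quaternion.inner_def, Quaternion.inner_def, star_mul]
  have h : (z : ℍ[ℝ]) * star (z : ℍ[ℝ]) = 1 := by
    rw [Quaternion.self_mul_star, Quaternion.normSq_eq_norm_mul_self]
    simp
  rw [mul_assoc, ← mul_assoc (z : ℍ[ℝ]), h, one_mul]

/-- Tangent vectors of the sphere are `q z` with `q` imaginary. -/
theorem exists_imag_mul_eq (z : S3) (v : TangentSpace (𝓡 3) z) :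
    ∃ r : ℍ[ℝ], r.re = 0 ∧ tangentIncl z v = r * z := by
  refine ⟨tangentIncl z v * star (z : ℍ[ℝ]), ?_, ?_⟩
  · have := inner_tangentIncl z v
    rw [real_inner_comm, Quaternion.inner_def] at this
    exact this
  · rw [mul_assoc, star_mul_self_sphere, mul_one]

theorem inner_eq_of_re_eq_zero {a : ℍ[ℝ]} (ha : a.re = 0) (b : ℍ[ℝ]) :
    ⟪a, b⟫_ℝ = a.imI * b.imI + a.imJ * b.imJ + a.imK * b.imK := by
  simp [Quaternion.inner_def, ha]

theorem inner_mul_eq_of_re_eq_zero {a b c : ℍ[ℝ]} (ha : a.re = 0) (hb : b.re = 0) (hc : c.re = 0) :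
    ⟪a * b, c⟫_ℝ = a.imI * (b.imJ * c.imK - b.imK * c.imJ) +
      a.imJ * (b.imK * c.imI - b.imI * c.imK) + a.imK * (b.imI * c.imJ - b.imJ * c.imI) := by
  simp [Quaternion.inner_def, ha, hb, hc]
  ring

/-- A linear relation with coefficients g, evaluated on the tangent vector Qz for Q = ∑ g i P i,
gives |Q|² = 0. -/
theorem linearIndependent_invForm {P : Fin 3 → ℍ[ℝ]} (hP : ∀ i, (P i).re = 0)
    (hli : LinearIndependent ℝ P) (z : S3) :
    LinearIndependent ℝ (fun i => invForm (P i) z) := by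
  rw [Fintype.linearIndependent_iff] at hli ⊢
  intro g hg
  apply hli
  set Q := ∑ i, g i • P i with hQ
  have hre : Q.re = 0 := by
    simp [hQ, hP, Fin.sum_univ_three]
  obtain ⟨v, hv⟩ := exists_tangentIncl_eq z (w := Q * z) (by
    have := inner_mul_sphere z 1 Q
    rw [one_mul] at this
    rw [this]
    simp [Quaternion.inner_def, hre])
  have h1 : ∑ i, g i * invForm (P i) z v = 0 := by
    have := congrArg (fun L => L v) hg
    simpa using this
  have h2 : ∑ i, g i * invForm (P i) z v = ⟪Q, Q⟫_ℝ := by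
    simp only [invForm_apply, hv, inner_mul_sphere]
    conv_rhs => rw [hQ]
    rw [sum_inner]
    simp [real_inner_smul_left, hQ]
  rw [h2] at h1
  exact inner_self_eq_zero.1 h1

end Sphere

/-! ### Structure equations on S³ and identification of the limit -/

section SphereStructure

variable {P : Fin 3 → ℍ[ℝ]}

/-- The structure coefficients of the coframe `invForm (P i)`. -/
noncomputable def sphereCoeff (P : Fin 3 → ℍ[ℝ]) (i : Fin 3) : Fin 3 → Fin 3 → ℝ :=
  ![![0, 2 * ⟪P i, P 2⟫_ℝ / ⟪P 0 * P 1, P 2⟫_ℝ, -(2 * ⟪P i, P 1⟫_ℝ / ⟪P 0 * P 1, P 2⟫_ℝ)],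
    ![0, 0, 2 * ⟪P i, P 0⟫_ℝ / ⟪P 0 * P 1, P 2⟫_ℝ], ![0, 0, 0]]

/-- On tangent vectors qz, rz the left side is 2 P i · (q×r), and the wedge products are (P j × P l)
· (q×r). The coefficients are those of 2 P i expanded in the cross products P j × P l. -/
theorem extD_invForm_eq_sum (hP : ∀ i, (P i).re = 0) (hD : ⟪P 0 * P 1, P 2⟫_ℝ ≠ 0) (i : Fin 3)
    (z : S3) (u v : TangentSpace (𝓡 3) z) : extD (invForm (P i)) z u v =
      ∑ j, ∑ l ∈ Finset.Ioi j,
        sphereCoeff P i j l * wedge (invForm (P j) z) (invForm (P l) z) u v := by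
  rw [extD_invForm (hP i), sum_Ioi_wedge (sphereCoeff P i) (fun j => invForm (P j) z)]
  obtain ⟨q, hq, hqu⟩ := exists_imag_mul_eq z u
  obtain ⟨r, hr, hrv⟩ := exists_imag_mul_eq z v
  simp only [wedge, invForm_apply, hqu, hrv, inner_mul_sphere, ← mul_assoc]
  simp [sphereCoeff]
  have hDe := inner_mul_eq_of_re_eq_zero (hP 0) (hP 1) (hP 2)
  rw [inner_mul_eq_of_re_eq_zero (hP i) hq hr]
  simp only [inner_eq_of_re_eq_zero (hP _)]
  generalize ⟪P 0 * P 1, P 2⟫_ℝ = D at *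
  field_simp
  rw [hDe]
  ring

theorem sphereCoeff_pos (hD : 0 < ⟪P 0 * P 1, P 2⟫_ℝ) :
    0 < sphereCoeff P 0 1 2 := by
  have h0 : P 0 ≠ 0 := by
    rintro h
    simp [h] at hD
  have : 0 < ⟪P 0, P 0⟫_ℝ := real_inner_self_pos.2 h0
  change 0 < 2 * ⟪P 0, P 0⟫_ℝ / ⟪P 0 * P 1, P 2⟫_ℝ
  positivity

theorem lieAlgebraIsSU2_sphereCoeff (hP : ∀ i, (P i).re = 0) (hD : 0 < ⟪P 0 * P 1, P 2⟫_ℝ) :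
    LieAlgebraIsSU2 (sphereCoeff P) := by
  refine lieAlgebraIsSU2_of_gram (P := fun i => ![(P i).imI, (P i).imJ, (P i).imK])
    (D := ⟪P 0 * P 1, P 2⟫_ℝ) ?_ hD.ne' ?_ ?_ ?_
  · rw [inner_mul_eq_of_re_eq_zero (hP 0) (hP 1) (hP 2)]
    simp
  all_goals
    intro i
    simp [sphereCoeff, inner_eq_of_re_eq_zero (hP i)]

theorem isHomogeneousContact_invForm (hP : ∀ i, (P i).re = 0) (hli : LinearIndependent ℝ P)
    (hD : 0 < ⟪P 0 * P 1, P 2⟫_ℝ) :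
    IsHomogeneousContact (fun i => invForm (P i)) (sphereCoeff P) where
  smooth i := smoothForm_invForm (P i)
  basis z := linearIndependent_invForm hP hli z
  structure_eq i z u v := extD_invForm_eq_sum hP hD.ne' i z u v
  contact := by
    refine ⟨smoothForm_invForm (P 0), fun z => ?_⟩
    have hpos := sphereCoeff_pos hD
    have hb := linearIndependent_invForm hP hli z
    set e : Fin 3 → OneForm S3 ℝ := fun i => invForm (P i)
    refine ⟨dualFrame e 0 z, dualFrame e 1 z, dualFrame e 2 z, ?_⟩
    have hd := coframe_dualFrame (e := e) (x := z) hb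
    have hs : ∀ u v, extD (invForm (P 0)) z u v = _ :=
      fun u v => (extD_invForm_eq_sum hP hD.ne' 0 z u v).trans
        (sum_Ioi_wedge (sphereCoeff P 0) (fun j => e j z) u v)
    change wedge12 (e 0 z) (extD (invForm (P 0)) z) _ _ _ ≠ 0
    simp only [wedge12, hs, wedge, hd, Fin.reduceEq, if_true, if_false]
    norm_num
    exact hpos.ne'

theorem mul_self_of_re_eq_zero {p : ℍ[ℝ]} (hp : p.re = 0) :
    p * p = -((‖p‖ ^ 2 : ℝ) : ℍ[ℝ]) := by
  have h : star p = -p := Quaternion.star_eq_neg.2 hp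
  have := Quaternion.self_mul_star p
  rw [h, Quaternion.normSq_eq_norm_mul_self] at this
  rw [pow_two, ← this]
  simp

/-- Inserting the Reeb field into `d1` and `d2` shows that J'v is a positive multiple of P₀v, and
J'² = -1 then determines the multiple. -/
theorem tangentIncl_homJ (hP : ∀ i, (P i).re = 0) {κ s p q a c d : ℝ}
    (H : IsReduced (fun i => invForm (P i)) κ s p q a c d) (hP0 : P 0 ≠ 0) (z : S3)
    (v : TangentSpace (𝓡 3) z) (hv : invForm (P 0) z v = 0) :
    tangentIncl z (homJ (fun i => invForm (P i)) a c z v) =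
      (‖P 0‖⁻¹ • P 0) * tangentIncl z v := by
  set e : Fin 3 → OneForm S3 ℝ := fun i => invForm (P i) with he
  have hn : 0 < ‖P 0‖ := norm_pos_iff.2 hP0
  have hs := H.s_pos
  have hsq : P 0 * P 0 = -((‖P 0‖ ^ 2 : ℝ) : ℍ[ℝ]) := mul_self_of_re_eq_zero (hP 0)
  have hinner : ∀ w : ℍ[ℝ], ⟪(z : ℍ[ℝ]), P 0 * w⟫_ℝ = -⟪P 0 * z, w⟫_ℝ := by
    intro w
    rw [real_inner_comm, inner_imag_mul_comm (hP 0)]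
  -- T is the Reeb field: P₀T is a multiple of the normal z, so T is in the kernel of the
  -- differential of the contact form.
  obtain ⟨T, hT⟩ := exists_tangentIncl_eq z (w := (‖P 0‖ ^ 2)⁻¹ • (P 0 * z)) (by
    rw [real_inner_smul_right, hinner]
    have := inner_mul_sphere z (P 0) 1
    rw [one_mul] at this
    rw [this]
    simp [Quaternion.inner_def, hP 0])
  have hextT : ∀ i u, extD (e i) z T u =
      2 * ((‖P 0‖ ^ 2)⁻¹ * ⟪P i * (P 0 * z), tangentIncl z u⟫_ℝ) := by
    intro i u
    rw [he, extD_invForm (hP i), hT, mul_smul_comm, real_inner_smul_left]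
  have hext0 : ∀ u, extD (e 0) z T u = 0 := by
    intro u
    rw [hextT, ← mul_assoc (P 0), hsq, neg_mul, inner_neg_left, Quaternion.coe_mul_eq_smul,
      real_inner_smul_left, inner_tangentIncl]
    simp
  have hT0 : e 0 z T = 1 := by
    change ⟪P 0 * z, tangentIncl z T⟫_ℝ = 1
    rw [hT, real_inner_smul_right, inner_mul_sphere, real_inner_self_eq_norm_sq]
    field_simp
  obtain ⟨s0, s1, s2⟩ := H.coframe_dualFrame_one z
  obtain ⟨t0, t1, t2⟩ := H.coframe_dualFrame_two z
  have hT1 : e 1 z T - p * e 0 z T = 0 := by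
    have h1 := hext0 (dualFrame e 2 z)
    rw [H.d0] at h1
    simp only [wedge, t0, t1, t2] at h1
    have := (mul_eq_zero.1 h1).resolve_left H.κ_pos.ne'
    linarith
  have hT2 : e 2 z T - q * e 0 z T = 0 := by
    have h1 := hext0 (dualFrame e 1 z)
    rw [H.d0] at h1
    simp only [wedge, s0, s1, s2] at h1
    have := (mul_eq_zero.1 h1).resolve_left H.κ_pos.ne'
    linarith
  have hd : (1 + a ^ 2) / c = d := by
    rw [← H.det]
    field_simp [H.c_pos.ne']
  have key : ∀ v, e 0 z v = 0 →
      tangentIncl z (homJ e a c z v) = (2 / (s * ‖P 0‖ ^ 2)) • (P 0 * tangentIncl z v) := by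
    intro v hv
    obtain ⟨j0, j1, j2⟩ := coframe_homJ (H.basis z) a c v
    have k1 := H.d1 z T v
    have k2 := H.d2 z T v
    simp only [hext0, hextT, wedge, hT0, hv] at k1 k2
    obtain ⟨w, hw⟩ := exists_tangentIncl_eq z (w := P 0 * tangentIncl z v) (by
      rw [hinner]
      exact neg_eq_zero.2 hv)
    obtain ⟨r, hr, hrv⟩ := exists_imag_mul_eq z v
    -- For imaginary quaternions ⟨ab, c⟩ is the triple product, which is invariant under cyclic
    -- permutations.
    have hcomm : ∀ i, e i z w = ⟪P i * (P 0 * z), tangentIncl z v⟫_ℝ := by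
      intro i
      change ⟪P i * z, tangentIncl z w⟫_ℝ = _
      rw [hw, hrv, ← mul_assoc, ← mul_assoc, inner_mul_sphere, inner_mul_sphere]
      rw [real_inner_comm, inner_mul_eq_of_re_eq_zero (hP 0) hr (hP i),
        inner_mul_eq_of_re_eq_zero (hP i) (hP 0) hr]
      ring
    have : homJ e a c z v = (2 / (s * ‖P 0‖ ^ 2)) • w := by
      refine coframe_ext (H.basis z) fun i => ?_
      rw [map_smul]
      fin_cases i
      · change e 0 z _ = _ • e 0 z w
        rw [j0, hcomm, ← mul_assoc (P 0), hsq, neg_mul, inner_neg_left, Quaternion.coe_mul_eq_smul,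
          real_inner_smul_left, inner_tangentIncl]
        simp
      · change e 1 z _ = _ • e 1 z w
        rw [j1, hcomm, hd, smul_eq_mul]
        field_simp
        field_simp at k1
        linarith
      · change e 2 z _ = _ • e 2 z w
        rw [j2, hcomm, smul_eq_mul]
        field_simp
        field_simp at k2
        linarith
    rw [this, map_smul, hw]
  by_cases hv0 : v = 0
  · rw [hv0]
    simp
  have hJ0 : e 0 z (homJ e a c z v) = 0 := (coframe_homJ (H.basis z) a c v).1
  have h1 := key _ hJ0
  rw [(H.isPseudohermitian H.c_pos).sq z v hv, key v hv, mul_smul_comm, ← mul_assoc, hsq, neg_mul,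
    Quaternion.coe_mul_eq_smul, map_neg, smul_neg, smul_neg, neg_inj, smul_smul, smul_smul] at h1
  have hne : tangentIncl z v ≠ 0 := fun h => hv0 (tangentIncl_injective z (h.trans (map_zero _).symm))
  have h2 : (1 : ℝ) = 2 / (s * ‖P 0‖ ^ 2) * (2 / (s * ‖P 0‖ ^ 2)) * ‖P 0‖ ^ 2 :=
    smul_left_injective ℝ hne (by simpa using h1)
  have h3 : 2 / (s * ‖P 0‖ ^ 2) = ‖P 0‖⁻¹ := by
    have h4 : (2 / (s * ‖P 0‖ ^ 2) * ‖P 0‖) ^ 2 = 1 := by rw [h2]; ring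
    have h5 : 0 < 2 / (s * ‖P 0‖ ^ 2) * ‖P 0‖ := by positivity
    have h6 : 2 / (s * ‖P 0‖ ^ 2) * ‖P 0‖ = 1 := by
      nlinarith
    exact eq_inv_of_mul_eq_one_left h6
  rw [key v hv, h3, smul_mul_assoc]

end SphereStructure

end TorsionFlow

open TorsionFlow in
theorem mainTheorem5 :
    -- homogeneous contact manifolds with Lie algebra `su(2)`
    (∀ (M : Type*) [TopologicalSpace M] [T2Space M] [SecondCountableTopology M] [Nonempty M]
      [ChartedSpace E3 M] [IsManifold (𝓡 3) ∞ M]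
      (e : Fin 3 → OneForm M ℝ) (k : Fin 3 → Fin 3 → Fin 3 → ℝ),
      IsHomogeneousContact e k → 0 < k 0 1 2 → LieAlgebraIsSU2 k →
      ∃ a' c' : ℝ, 0 < c' ∧ IsTorsionFree (e 0) (homJ e a' c') ∧
        (∀ a c : ℝ, 0 < c → IsTorsionFree (e 0) (homJ e a c) → a = a' ∧ c = c') ∧
        ∀ a₀ c₀ : ℝ, 0 < c₀ → FlowConverges e a₀ c₀ a' c') ∧
    -- `SU(2)` with an invariant coframe; for `P 0 = i` the limit is the standard `J = i` on `S³`
    (∀ P : Fin 3 → ℍ[ℝ], (∀ i, (P i).re = 0) → LinearIndependent ℝ P →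
      0 < ⟪P 0 * P 1, P 2⟫_ℝ →
      (∃ k, IsHomogeneousContact (fun i => invForm (P i)) k ∧ 0 < k 0 1 2 ∧ LieAlgebraIsSU2 k) ∧
      ∃ a' c' : ℝ, 0 < c' ∧
        IsTorsionFree (invForm (P 0)) (homJ (fun i => invForm (P i)) a' c') ∧
        (∀ (z : S3) (v : TangentSpace (𝓡 3) z), invForm (P 0) z v = 0 →
          tangentIncl z (homJ (fun i => invForm (P i)) a' c' z v) =
            (‖P 0‖⁻¹ • P 0) * tangentIncl z v) ∧
        ∀ a₀ c₀ : ℝ, 0 < c₀ → FlowConverges (fun i => invForm (P i)) a₀ c₀ a' c') := by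
  refine ⟨?_, ?_⟩
  · intro M _ _ _ _ _ _ e k h hk hsu
    obtain ⟨s, p, q, a, c, d, H⟩ := h.exists_isReduced hk hsu
    exact ⟨a, c, H.c_pos, H.isTorsionFree, fun _ _ hc ht => H.eq_of_isTorsionFree hc ht,
      fun a₀ _ hc₀ => H.flowConverges a₀ hc₀⟩
  · intro P hP hli hD
    have h := isHomogeneousContact_invForm hP hli hD
    have hk := sphereCoeff_pos hD
    have hsu := lieAlgebraIsSU2_sphereCoeff hP hD
    obtain ⟨s, p, q, a, c, d, H⟩ := h.exists_isReduced hk hsu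
    have : Nonempty S3 := ⟨⟨1, by simp⟩⟩
    exact ⟨⟨sphereCoeff P, h, hk, hsu⟩, a, c, H.c_pos, H.isTorsionFree,
      fun z v hv => tangentIncl_homJ hP H (hli.ne_zero 0) z v hv,
      fun a₀ _ hc₀ => H.flowConverges a₀ hc₀⟩
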